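/- Let $\mathbb K$ be a field of any characteristic. A (possibly curved) shifted $A_\infty$-algebra $(A,Q)$ is a $\mathbb Z$-graded vector space $A$ over $\mathbb K$ with linear maps $Q_n\colon A^{\otimes n}\to A$ of degree $+1$, $n\ge 0$, such that, with the Koszul sign rule, $$\sum_{a+b+c=n}Q_{a+c+1}\circ(\mathrm{id}^{\otimes a}\otimes Q_b\otimes \mathrm{id}^{\otimes c})=0\qquad\text{for all } n\ge 0 .$$ It is complete if it is equipped with a decreasing filtration by graded subspaces $A=F^1A\supseteq F^2A\supseteq\cdots$ such that $\bigcap_k F^kA=0$, $Q_n(F^{i_1}A\otimes\cdots\otimes F^{i_n}A)\subseteq F^{i_1+\cdots+i_n}A$ (no condition on $Q_0$), and each graded piece $A^p$ is complete for the topology given by the filtration. In a shifted $A_\infty$-algebra with such a filtration, a Maurer–Cartan element is an element $x$ of degree $0$ with $\sum_{l\ge 0}Q_l(x,\dots,x)=0$, the series being summed in the topology of the filtration. Let $N^\bullet(\Delta^n)$ be the unital differential graded algebra of normalized cochains on the standard $n$-simplex with coefficients in $\mathbb K$, with the cup product. Let $A\otimes N^\bullet(\Delta^n)$ carry the filtration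 $F^kA\otimes N^\bullet(\Delta^n)$ and the operations $Q_0\otimes 1$, $Q_1\otimes\mathrm{id}+\mathrm{id}\otimes d$ and $Q_k\otimes\cup^{(k)}$ for $k\ge 2$ (Koszul signs understood), where $\cup^{(k)}$ is the $k$-fold cup product. Let $(A,Q)$ be any complete shifted $A_\infty$-algebra over $\mathbb K$. Then the Maurer–Cartan simplicial set $MC_\bullet(A,Q)$, whose $n$-simplices are the Maurer–Cartan elements of $A\otimes N^\bullet(\Delta^n)$ and whose face and degeneracy maps are induced by those of the simplicial algebra $N^\bullet(\Delta^\bullet)$, is a Kan complex. -/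

import Mathlib

open scoped TensorProduct

universe u v

namespace AInf

section Cochains

variable (K : Type*) [Field K]

/-- The normalized cochains `N^•(Δ^n)` with coefficients in `K`, all degrees together. The
nondegenerate simplices of `Δ^n` are the nonempty subsets `I = {i₀ < ⋯ < i_q}` of `{0, …, n}`, and a
normalized cochain is a function on these. It is extended by the value `0` at the empty set. -/
structure NCochain (n : ℕ) where
  toFun : Finset (Fin (n + 1)) → K
  map_empty' : toFun ∅ = 0

namespace NCochain

variable {K} {n : ℕ}

instance : FunLike (NCochain K n) (Finset (Fin (n + 1))) K where
  coe := toFun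
  coe_injective := by rintro ⟨f, _⟩ ⟨g, _⟩ h; simpa using h

@[ext] theorem ext {f g : NCochain K n} (h : ∀ I : Finset (Fin (n + 1)), f I = g I) : f = g :=
  DFunLike.ext _ _ h

@[simp] theorem mk_apply (f : Finset (Fin (n + 1)) → K) (h : f ∅ = 0) (I : Finset (Fin (n + 1))) :
    (⟨f, h⟩ : NCochain K n) I = f I := rfl

@[simp] theorem apply_empty (f : NCochain K n) : f ∅ = 0 := f.map_empty'

instance : Zero (NCochain K n) := ⟨⟨fun _ => 0, rfl⟩⟩

instance : Add (NCochain K n) := ⟨fun f g => ⟨fun I => f I + g I, by simp⟩⟩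

instance : Neg (NCochain K n) := ⟨fun f => ⟨fun I => -f I, by simp⟩⟩

instance : Sub (NCochain K n) := ⟨fun f g => ⟨fun I => f I - g I, by simp⟩⟩

instance : SMul ℕ (NCochain K n) := ⟨fun c f => ⟨fun I => c • f I, by simp⟩⟩

instance : SMul ℤ (NCochain K n) := ⟨fun c f => ⟨fun I => c • f I, by simp⟩⟩

instance : SMul K (NCochain K n) := ⟨fun c f => ⟨fun I => c * f I, by simp⟩⟩

instance : AddCommGroup (NCochain K n) :=
  Function.Injective.addCommGroup (fun f : NCochain K n => (f : Finset (Fin (n + 1)) → K))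
    DFunLike.coe_injective rfl (fun _ _ => rfl) (fun _ => rfl) (fun _ _ => rfl)
    (fun _ _ => rfl) (fun _ _ => rfl)

@[simp] theorem add_apply (f g : NCochain K n) (I : Finset (Fin (n + 1))) :
    (f + g) I = f I + g I := rfl

@[simp] theorem zero_apply (I : Finset (Fin (n + 1))) : (0 : NCochain K n) I = 0 := rfl

@[simp] theorem smul_apply (c : K) (f : NCochain K n) (I : Finset (Fin (n + 1))) :
    (c • f) I = c * f I := rfl

instance : Module K (NCochain K n) where
  one_smul f := by ext I; simp
  mul_smul a b f := by ext I; simp [mul_assoc]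
  smul_zero a := by ext I; simp
  smul_add a f g := by ext I; simp [mul_add]
  add_smul a b f := by ext I; simp [add_mul]
  zero_smul f := by ext I; simp

/-- Evaluation at a simplex. -/
def evalₗ (I : Finset (Fin (n + 1))) : NCochain K n →ₗ[K] K where
  toFun f := f I
  map_add' _ _ := rfl
  map_smul' _ _ := rfl

@[simp] theorem evalₗ_apply (I : Finset (Fin (n + 1))) (f : NCochain K n) : evalₗ I f = f I := rfl

theorem sum_apply {ι : Type*} (s : Finset ι) (f : ι → NCochain K n) (I : Finset (Fin (n + 1))) :
    (∑ j ∈ s, f j) I = ∑ j ∈ s, f j I := map_sum (evalₗ I) f s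

/-- The cup product. On a `(p+q)`-simplex `I` and for `f` of degree `p`, `g` of degree `q`, the only
summand that can be nonzero is (front `p`-face of `I`) times (back `q`-face of `I`). -/
instance : Mul (NCochain K n) where
  mul f g := ⟨fun I => ∑ i ∈ I, f (I.filter (· ≤ i)) * g (I.filter (i ≤ ·)), by simp⟩

/-- The unit is the sum of the duals of the vertices. -/
instance : One (NCochain K n) where
  one := ⟨fun I => if I.card = 1 then 1 else 0, by simp⟩

theorem mul_apply (f g : NCochain K n) (I : Finset (Fin (n + 1))) :
    (f * g) I = ∑ i ∈ I, f (I.filter (· ≤ i)) * g (I.filter (i ≤ ·)) := rfl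

theorem one_apply (I : Finset (Fin (n + 1))) :
    (1 : NCochain K n) I = if I.card = 1 then 1 else 0 := rfl

theorem cup_one_mul (f : NCochain K n) : 1 * f = f := by
  ext I
  rw [mul_apply]
  rcases I.eq_empty_or_nonempty with rfl | h
  · simp
  rw [Finset.sum_eq_single (I.min' h)]
  · have h1 : I.filter (· ≤ I.min' h) = {I.min' h} := by
      ext j
      simp only [Finset.mem_filter, Finset.mem_singleton]
      exact ⟨fun hj => le_antisymm hj.2 (I.min'_le j hj.1),
        fun hj => ⟨hj ▸ I.min'_mem h, hj.le⟩⟩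
    have h2 : I.filter (I.min' h ≤ ·) = I :=
      Finset.filter_true_of_mem fun j hj => I.min'_le j hj
    rw [h1, h2, one_apply]; simp
  · intro i hi hne
    rw [one_apply, if_neg, zero_mul]
    intro hc
    obtain ⟨a, ha⟩ := Finset.card_eq_one.1 hc
    have m1 : i ∈ I.filter (· ≤ i) := by simp [hi]
    have m2 : I.min' h ∈ I.filter (· ≤ i) := by simp [I.min'_mem h, I.min'_le i hi]
    rw [ha, Finset.mem_singleton] at m1 m2
    exact hne (m1.trans m2.symm)
  · intro hh; exact absurd (I.min'_mem h) hh

theorem cup_mul_one (f : NCochain K n) : f * 1 = f := by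
  ext I
  rw [mul_apply]
  rcases I.eq_empty_or_nonempty with rfl | h
  · simp
  rw [Finset.sum_eq_single (I.max' h)]
  · have h1 : I.filter (I.max' h ≤ ·) = {I.max' h} := by
      ext j
      simp only [Finset.mem_filter, Finset.mem_singleton]
      exact ⟨fun hj => le_antisymm (I.le_max' j hj.1) hj.2,
        fun hj => ⟨hj ▸ I.max'_mem h, hj.ge⟩⟩
    have h2 : I.filter (· ≤ I.max' h) = I :=
      Finset.filter_true_of_mem fun j hj => I.le_max' j hj
    rw [h1, h2, one_apply]; simp
  · intro i hi hne
    rw [one_apply, if_neg, mul_zero]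
    intro hc
    obtain ⟨a, ha⟩ := Finset.card_eq_one.1 hc
    have m1 : i ∈ I.filter (i ≤ ·) := by simp [hi]
    have m2 : I.max' h ∈ I.filter (i ≤ ·) := by simp [I.max'_mem h, I.le_max' i hi]
    rw [ha, Finset.mem_singleton] at m1 m2
    exact hne (m1.trans m2.symm)
  · intro hh; exact absurd (I.max'_mem h) hh

theorem cup_assoc (f g h : NCochain K n) : f * g * h = f * (g * h) := by
  ext I
  simp only [mul_apply, Finset.sum_mul, Finset.mul_sum, Finset.filter_filter]
  rw [Finset.sum_sigma', Finset.sum_sigma']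
  refine Finset.sum_bij' (fun x _ => ⟨x.2, x.1⟩) (fun x _ => ⟨x.2, x.1⟩) ?_ ?_ ?_ ?_ ?_
  · rintro ⟨i, j⟩ hx; simp only [Finset.mem_sigma, Finset.mem_filter] at hx ⊢; tauto
  · rintro ⟨i, j⟩ hx; simp only [Finset.mem_sigma, Finset.mem_filter] at hx ⊢; tauto
  · rintro ⟨i, j⟩ _; rfl
  · rintro ⟨i, j⟩ _; rfl
  · rintro ⟨i, j⟩ hx
    simp only [Finset.mem_sigma, Finset.mem_filter] at hx
    have hji := hx.2.2
    have e1 : I.filter (fun a => a ≤ i ∧ a ≤ j) = I.filter (· ≤ j) :=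
      Finset.filter_congr fun a _ => ⟨fun h => h.2, fun h => ⟨h.trans hji, h⟩⟩
    have e2 : I.filter (fun a => j ≤ a ∧ i ≤ a) = I.filter (i ≤ ·) :=
      Finset.filter_congr fun a _ => ⟨fun h => h.2, fun h => ⟨hji.trans h, h⟩⟩
    have e3 : I.filter (fun a => a ≤ i ∧ j ≤ a) = I.filter (fun a => j ≤ a ∧ a ≤ i) :=
      Finset.filter_congr fun a _ => and_comm
    simp only [e1, e2, e3, mul_assoc]

noncomputable instance : Ring (NCochain K n) :=
  { (inferInstance : AddCommGroup (NCochain K n)), (inferInstance : Mul (NCochain K n)),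
    (inferInstance : One (NCochain K n)) with
    left_distrib := by
      intro f g h; ext I; simp [mul_apply, mul_add, Finset.sum_add_distrib]
    right_distrib := by
      intro f g h; ext I; simp [mul_apply, add_mul, Finset.sum_add_distrib]
    zero_mul := by intro f; ext I; simp [mul_apply]
    mul_zero := by intro f; ext I; simp [mul_apply]
    mul_assoc := cup_assoc
    one_mul := cup_one_mul
    mul_one := cup_mul_one }

noncomputable instance : Algebra K (NCochain K n) :=
  Algebra.ofModule
    (by intro c f g; ext I; simp [mul_apply, Finset.mul_sum, mul_assoc])
    (by intro c f g; ext I; simp [mul_apply, Finset.mul_sum, mul_left_comm])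

/-- The differential `(d f)(i₀, …, i_q) = ∑ₗ (-1)^l f(i₀, …, î_l, …, i_q)`. -/
noncomputable def d : NCochain K n →ₗ[K] NCochain K n where
  toFun f := ⟨fun I => ∑ i ∈ I, (-1) ^ (I.filter (· < i)).card * f (I.erase i), by simp⟩
  map_add' f g := by ext I; simp [mul_add, Finset.sum_add_distrib]
  map_smul' c f := by ext I; simp [Finset.mul_sum, mul_left_comm]

theorem d_apply (f : NCochain K n) (I : Finset (Fin (n + 1))) :
    d f I = ∑ i ∈ I, (-1) ^ (I.filter (· < i)).card * f (I.erase i) := rfl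

/-- The cochains of degree `q`: those supported on the `q`-dimensional simplices. -/
def gr (q : ℕ) : Submodule K (NCochain K n) where
  carrier := {f | ∀ I : Finset (Fin (n + 1)), I.card ≠ q + 1 → f I = 0}
  add_mem' := by intro f g hf hg I hI; simp [hf I hI, hg I hI]
  zero_mem' := by intro I _; rfl
  smul_mem' := by intro c f hf I hI; simp [hf I hI]

/-- The nondegenerate simplices of `Δ^n`. -/
abbrev Simplex (n : ℕ) : Type := {I : Finset (Fin (n + 1)) // I.Nonempty}

def Simplex.dim (I : Simplex n) : ℕ := I.1.card - 1

/-- The basis element `φ_I`: it is `1` on the simplex `I` and `0` on all others. -/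
def φ (I : Simplex n) : NCochain K n :=
  ⟨fun J => if J = I.1 then 1 else 0, by simp [I.2.ne_empty.symm]⟩

theorem φ_apply (I : Simplex n) (J : Finset (Fin (n + 1))) :
    (φ I : NCochain K n) J = if J = I.1 then 1 else 0 := rfl

theorem sum_φ (f : NCochain K n) : ∑ I : Simplex n, f I.1 • φ I = f := by
  ext J
  rw [sum_apply]
  rcases J.eq_empty_or_nonempty with rfl | h
  · simp
  rw [Finset.sum_eq_single (⟨J, h⟩ : Simplex n)]
  · simp [φ_apply]
  · intro I _ hne
    rw [smul_apply, φ_apply, if_neg, mul_zero]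
    rintro rfl; exact hne rfl
  · simp

theorem prod_expand {k : ℕ} (c : Fin k → NCochain K n) :
    (List.ofFn c).prod = ∑ I : Fin k → Simplex n,
      (∏ j, c j (I j).1) • (List.ofFn fun j => (φ (I j) : NCochain K n)).prod := by
  have h := (MultilinearMap.mkPiAlgebraFin K k (NCochain K n)).map_sum
    (fun j (I : Simplex n) => c j I.1 • (φ I : NCochain K n))
  simp only [sum_φ, MultilinearMap.map_smul_univ, MultilinearMap.mkPiAlgebraFin_apply] at h
  exact h

section Pullback

variable {m : ℕ}

/-- The map of cochains induced by a monotone map `θ : [m] → [n]`; a cochain vanishes on the image of a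
simplex that becomes degenerate. -/
def pullFun (θ : Fin (m + 1) →o Fin (n + 1)) (f : NCochain K n) : NCochain K m :=
  ⟨fun I => if Set.InjOn θ (I : Set (Fin (m + 1))) then f (I.image θ) else 0, by simp⟩

theorem pullFun_apply (θ : Fin (m + 1) →o Fin (n + 1)) (f : NCochain K n)
    (I : Finset (Fin (m + 1))) :
    pullFun θ f I = if Set.InjOn θ (I : Set (Fin (m + 1))) then f (I.image θ) else 0 := rfl

theorem pullFun_mul (θ : Fin (m + 1) →o Fin (n + 1)) (f g : NCochain K n) :
    pullFun θ (f * g) = pullFun θ f * pullFun θ g := by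
  ext I
  rw [pullFun_apply, mul_apply]
  split_ifs with h
  · rw [mul_apply, Finset.sum_image h]
    refine Finset.sum_congr rfl fun i hi => ?_
    rw [pullFun_apply, pullFun_apply, if_pos, if_pos]
    · congr 2
      · ext y
        simp only [Finset.mem_filter, Finset.mem_image]
        constructor
        · rintro ⟨⟨a, ha, rfl⟩, hle⟩
          refine ⟨a, ⟨ha, ?_⟩, rfl⟩
          by_contra hlt
          exact hlt (h ha hi (le_antisymm hle (θ.monotone (not_le.1 hlt).le))).le
        · rintro ⟨a, ⟨ha, hle⟩, rfl⟩
          exact ⟨⟨a, ha, rfl⟩, θ.monotone hle⟩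
      · ext y
        simp only [Finset.mem_filter, Finset.mem_image]
        constructor
        · rintro ⟨⟨a, ha, rfl⟩, hle⟩
          refine ⟨a, ⟨ha, ?_⟩, rfl⟩
          by_contra hlt
          exact hlt (h hi ha (le_antisymm hle (θ.monotone (not_le.1 hlt).le))).le
        · rintro ⟨a, ⟨ha, hle⟩, rfl⟩
          exact ⟨⟨a, ha, rfl⟩, θ.monotone hle⟩
    · exact h.mono (by exact_mod_cast Finset.filter_subset _ _)
    · exact h.mono (by exact_mod_cast Finset.filter_subset _ _)
  · symm
    refine Finset.sum_eq_zero fun i hi => ?_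
    rw [pullFun_apply, pullFun_apply]
    by_contra hne
    have h1 : Set.InjOn θ ((I.filter (· ≤ i) : Finset _) : Set (Fin (m + 1))) := by
      by_contra hh; apply hne; simp only [if_neg hh, zero_mul]
    have h2 : Set.InjOn θ ((I.filter (i ≤ ·) : Finset _) : Set (Fin (m + 1))) := by
      by_contra hh; apply hne; simp only [if_neg hh, mul_zero]
    apply h
    have key : ∀ a ∈ I, ∀ b ∈ I, a ≤ b → θ a = θ b → a = b := by
      intro a ha b hb hab he
      rcases le_total b i with hbi | hib
      · exact h1 (by simp [ha, hab.trans hbi]) (by simp [hb, hbi]) he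
      rcases le_total i a with hia | hai
      · exact h2 (by simp [ha, hia]) (by simp [hb, hib]) he
      · have e1 : θ a = θ i := le_antisymm (θ.monotone hai) (he ▸ θ.monotone hib)
        have r1 : a = i := h1 (by simp [ha, hai]) (by simp [hi]) e1
        have r2 : i = b := h2 (by simp [hi]) (by simp [hb, hib]) (e1.symm.trans he)
        exact r1.trans r2
    intro a ha b hb he
    rcases le_total a b with hab | hab
    · exact key a ha b hb hab he
    · exact (key b hb a ha hab he.symm).symm

theorem pullFun_one (θ : Fin (m + 1) →o Fin (n + 1)) :
    pullFun θ (1 : NCochain K n) = 1 := by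
  ext I
  rw [pullFun_apply, one_apply, one_apply]
  by_cases h : Set.InjOn θ (I : Set (Fin (m + 1)))
  · rw [if_pos h, Finset.card_image_of_injOn h]
  · rw [if_neg h, if_neg]
    intro hc
    obtain ⟨a, rfl⟩ := Finset.card_eq_one.1 hc
    simp at h

/-- `pullFun` as a homomorphism of unital algebras. -/
noncomputable def pull (θ : Fin (m + 1) →o Fin (n + 1)) : NCochain K n →ₐ[K] NCochain K m :=
  AlgHom.ofLinearMap
    { toFun := pullFun θ
      map_add' := by
        intro f g; ext I; simp only [pullFun_apply, add_apply]; split_ifs <;> simp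
      map_smul' := by
        intro c f; ext I; simp only [pullFun_apply, smul_apply, RingHom.id_apply]; split_ifs <;> simp }
    (pullFun_one θ) (pullFun_mul θ)

theorem pull_apply (θ : Fin (m + 1) →o Fin (n + 1)) (f : NCochain K n)
    (I : Finset (Fin (m + 1))) :
    pull θ f I = if Set.InjOn θ (I : Set (Fin (m + 1))) then f (I.image θ) else 0 := rfl

theorem pull_id : pull (K := K) (OrderHom.id : Fin (n + 1) →o Fin (n + 1)) = AlgHom.id K _ := by
  ext f I
  rw [pull_apply]
  simp [Set.injOn_id]

theorem pull_comp {l : ℕ} (θ : Fin (m + 1) →o Fin (n + 1)) (η : Fin (l + 1) →o Fin (m + 1))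
    (f : NCochain K n) : pull (θ.comp η) f = pull η (pull θ f) := by
  ext I
  rw [pull_apply, pull_apply]
  by_cases h : Set.InjOn η (I : Set (Fin (l + 1)))
  · rw [if_pos h, pull_apply, Finset.image_image]
    have : Set.InjOn (θ.comp η) (I : Set (Fin (l + 1))) ↔
        Set.InjOn θ ((I.image η : Finset _) : Set (Fin (m + 1))) := by
      rw [Finset.coe_image, ← h.comp_iff]; rfl
    simp only [this]; rfl
  · rw [if_neg h, if_neg]
    intro h'
    exact h fun a ha b hb he => h' ha hb (by simp [he])

theorem pull_mem_gr (θ : Fin (m + 1) →o Fin (n + 1)) {q : ℕ} {f : NCochain K n}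
    (hf : f ∈ gr (K := K) q) : pull θ f ∈ gr (K := K) q := by
  intro I hI
  rw [pull_apply]
  split_ifs with h
  · exact hf _ (by rwa [Finset.card_image_of_injOn h])
  · rfl

theorem pull_d (θ : Fin (m + 1) →o Fin (n + 1)) (f : NCochain K n) :
    pull θ (d f) = d (pull θ f) := by
  ext I
  rw [pull_apply, d_apply, d_apply]
  split_ifs with h
  · rw [Finset.sum_image h]
    refine Finset.sum_congr rfl fun i hi => ?_
    rw [pull_apply, if_pos (h.mono (by simp))]
    have e1 : ((I.image θ).filter (· < θ i)) = (I.filter (· < i)).image θ := by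
      ext y
      simp only [Finset.mem_filter, Finset.mem_image]
      constructor
      · rintro ⟨⟨a, ha, rfl⟩, hlt⟩
        exact ⟨a, ⟨ha, lt_of_not_ge fun hge => (θ.monotone hge).not_gt hlt⟩, rfl⟩
      · rintro ⟨a, ⟨ha, hlt⟩, rfl⟩
        exact ⟨⟨a, ha, rfl⟩, lt_of_le_of_ne (θ.monotone hlt.le) fun he => hlt.ne (h ha hi he)⟩
    have e2 : (I.image θ).erase (θ i) = (I.erase i).image θ := by
      ext y
      simp only [Finset.mem_erase, Finset.mem_image]
      constructor
      · rintro ⟨hne, a, ha, rfl⟩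
        exact ⟨a, ⟨fun he => hne (he ▸ rfl), ha⟩, rfl⟩
      · rintro ⟨a, ⟨hne, ha⟩, rfl⟩
        exact ⟨fun he => hne (h ha hi he), a, ha, rfl⟩
    rw [e1, e2, Finset.card_image_of_injOn (h.mono (by exact_mod_cast Finset.filter_subset _ _))]
  · symm
    -- choose a collision `a < b`
    have : ∃ a ∈ I, ∃ b ∈ I, a < b ∧ θ a = θ b := by
      by_contra hno
      push Not at hno
      apply h
      intro a ha b hb he
      rcases lt_trichotomy a b with hab | hab | hab
      · exact absurd he (hno a ha b hb hab)
      · exact hab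
      · exact absurd he.symm (hno b hb a ha hab)
    obtain ⟨a, ha, b, hb, hab, he⟩ := this
    have hz : ∀ i ∈ I, i ≠ a → i ≠ b → pull θ f (I.erase i) = 0 := by
      intro i hi hia hib
      rw [pull_apply, if_neg]
      intro hinj
      exact hab.ne (hinj (by simp [ha, hia.symm]) (by simp [hb, hib.symm]) he)
    rw [← Finset.add_sum_erase _ _ ha,
      ← Finset.add_sum_erase _ _ (Finset.mem_erase.2 ⟨hab.ne', hb⟩),
      Finset.sum_eq_zero, add_zero]
    · by_cases hmid : ∃ c ∈ I, a < c ∧ c < b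
      · obtain ⟨c, hc, hac, hcb⟩ := hmid
        have hca : θ a = θ c := le_antisymm (θ.monotone hac.le) (he ▸ θ.monotone hcb.le)
        have z1 : pull θ f (I.erase a) = 0 := by
          rw [pull_apply, if_neg]
          intro hinj
          exact hcb.ne (hinj (by simp [hc, hac.ne']) (by simp [hb, hab.ne']) (hca.symm.trans he))
        have z2 : pull θ f (I.erase b) = 0 := by
          rw [pull_apply, if_neg]
          intro hinj
          exact hac.ne (hinj (by simp [ha, hab.ne]) (by simp [hc, hcb.ne]) hca)
        rw [z1, z2]; simp
      · push Not at hmid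
        have hcard : (I.filter (· < b)).card = (I.filter (· < a)).card + 1 := by
          have : I.filter (· < b) = insert a (I.filter (· < a)) := by
            ext c
            simp only [Finset.mem_filter, Finset.mem_insert]
            constructor
            · rintro ⟨hc, hcb⟩
              rcases lt_trichotomy c a with h1 | h1 | h1
              · exact Or.inr ⟨hc, h1⟩
              · exact Or.inl h1
              · exact absurd hcb (not_lt.2 (hmid c hc h1))
            · rintro (rfl | ⟨hc, h1⟩)
              · exact ⟨ha, hab⟩
              · exact ⟨hc, h1.trans hab⟩
          rw [this, Finset.card_insert_of_notMem (by simp)]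
        have himg : (I.erase a).image θ = (I.erase b).image θ := by
          ext y
          simp only [Finset.mem_erase, Finset.mem_image]
          constructor
          · rintro ⟨c, ⟨hca, hc⟩, rfl⟩
            by_cases hcb : c = b
            · exact ⟨a, ⟨hab.ne, ha⟩, by rw [hcb, he]⟩
            · exact ⟨c, ⟨hcb, hc⟩, rfl⟩
          · rintro ⟨c, ⟨hcb, hc⟩, rfl⟩
            by_cases hca : c = a
            · exact ⟨b, ⟨hab.ne', hb⟩, by rw [hca, he]⟩
            · exact ⟨c, ⟨hca, hc⟩, rfl⟩
        have hinj : Set.InjOn θ ((I.erase a : Finset _) : Set (Fin (m + 1))) ↔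
            Set.InjOn θ ((I.erase b : Finset _) : Set (Fin (m + 1))) := by
          rw [← Finset.card_image_iff, ← Finset.card_image_iff, himg,
            Finset.card_erase_of_mem ha, Finset.card_erase_of_mem hb]
        rw [pull_apply, pull_apply, himg, hcard]
        simp only [hinj]
        ring
    · intro i hi
      simp only [Finset.mem_erase] at hi
      rw [hz i hi.2.2 hi.2.1 hi.1, mul_zero]

end Pullback

end NCochain

end Cochains

section Algebras

variable {K : Type v} [Field K] {A : Type u} [AddCommGroup A] [Module K A]

/-- The sequence `a₀, …, a_{s-1}, z, a_{s+b}, a_{s+b+1}, …`, in which `z` replaces the block of length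
`b` that starts at position `s`. -/
def insertAt (a : ℕ → A) (s b : ℕ) (z : A) : ℕ → A :=
  fun i => if i < s then a i else if i = s then z else a (i - 1 + b)

variable (K A) in
/-- A (possibly curved) shifted `A_∞`-algebra with underlying `ℤ`-graded vector space `A = ⨁ gr p`:
operations `Q n : A^{⊗n} → A` of degree `+1` for all `n ≥ 0` (`Q 0` is the curvature) with
`∑_{s+b+t=n} Q_{s+t+1} ∘ (id^{⊗s} ⊗ Q_b ⊗ id^{⊗t}) = 0` for all `n ≥ 0`. The Koszul sign is
`(-1)^{|a₀| + ⋯ + |a_{s-1}|}`, as `Q_b` of degree `1` passes the first `s` arguments. -/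
structure ShiftedAInfAlgebra where
  gr : ℤ → Submodule K A
  isInternal : DirectSum.IsInternal gr
  Q : (n : ℕ) → MultilinearMap K (fun _ : Fin n => A) A
  Q_mem_gr : ∀ (n : ℕ) (d : Fin n → ℤ) (a : Fin n → A),
    (∀ i, a i ∈ gr (d i)) → Q n a ∈ gr ((∑ i, d i) + 1)
  assoc : ∀ (n : ℕ) (d : ℕ → ℤ) (a : ℕ → A), (∀ i < n, a i ∈ gr (d i)) →
    ∑ p ∈ Finset.HasAntidiagonal.antidiagonal n, ∑ q ∈ Finset.HasAntidiagonal.antidiagonal p.2,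
      (∑ i ∈ Finset.range p.1, d i).negOnePow •
        Q (p.1 + 1 + q.2) (fun i => insertAt a p.1 q.1 (Q q.1 fun j => a (p.1 + j)) i) = 0

variable (K A) in
/-- A shifted `A_∞`-algebra with a decreasing separated filtration `A = F 1 ⊇ F 2 ⊇ ⋯` by graded
subspaces that the operations respect. By convention `F 0 = A`. -/
structure FilteredShiftedAInfAlgebra extends ShiftedAInfAlgebra K A where
  F : ℕ → Submodule K A
  F_antitone : Antitone F
  F_one : F 1 = ⊤
  F_homogeneous : ∀ k, F k ≤ ⨆ p, F k ⊓ gr p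
  iInf_F : ⨅ k, F k = ⊥
  Q_mem_F : ∀ (n : ℕ) (k : Fin n → ℕ) (a : Fin n → A),
    (∀ i, a i ∈ F (k i)) → Q n a ∈ F (∑ i, k i)

namespace FilteredShiftedAInfAlgebra

/-- Completeness for the filtration metric, in every degree: each Cauchy sequence of elements of degree
`p` has a limit of degree `p`. -/
def IsComplete (𝔸 : FilteredShiftedAInfAlgebra K A) : Prop :=
  ∀ (p : ℤ) (x : ℕ → A), (∀ n, x n ∈ 𝔸.gr p) →
    (∀ k, ∃ N, ∀ m ≥ N, ∀ n ≥ N, x m - x n ∈ 𝔸.F k) →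
    ∃ y ∈ 𝔸.gr p, ∀ k, ∃ N, ∀ n ≥ N, x n - y ∈ 𝔸.F k

end FilteredShiftedAInfAlgebra

namespace ShiftedAInfAlgebra

variable (𝔸 : ShiftedAInfAlgebra K A) (n : ℕ)

/-- The linear operator `a ↦ (-1)^{|a|} a`. -/
noncomputable def parity : A →ₗ[K] A :=
  (DirectSum.toModule K ℤ A fun p => ((p.negOnePow : ℤˣ) : ℤ) • (𝔸.gr p).subtype) ∘ₗ
    (LinearEquiv.ofBijective (DirectSum.coeLinearMap 𝔸.gr) 𝔸.isInternal).symm.toLinearMap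

theorem parity_of_mem {p : ℤ} {a : A} (ha : a ∈ 𝔸.gr p) : 𝔸.parity a = p.negOnePow • a := by
  have : (LinearEquiv.ofBijective (DirectSum.coeLinearMap 𝔸.gr) 𝔸.isInternal).symm a
      = DirectSum.lof K ℤ (fun i => 𝔸.gr i) p ⟨a, ha⟩ := by
    rw [LinearEquiv.symm_apply_eq]
    exact (DirectSum.coeLinearMap_lof 𝔸.gr p ⟨a, ha⟩).symm
  simp only [parity, LinearMap.comp_apply, LinearEquiv.coe_coe, this, DirectSum.toModule_lof]
  rfl

variable (K A) in
/-- The coefficient of `φ_I`: the map `A ⊗ N^•(Δ^n) → A`, `a ⊗ c ↦ c(I) a`. -/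
noncomputable def coord {n : ℕ} (I : Finset (Fin (n + 1))) : A ⊗[K] NCochain K n →ₗ[K] A :=
  (TensorProduct.rid K A).toLinearMap ∘ₗ LinearMap.lTensor A (NCochain.evalₗ I)

theorem coord_tmul {n : ℕ} (I : Finset (Fin (n + 1))) (a : A) (c : NCochain K n) :
    coord K A I (a ⊗ₜ c) = c I • a := by
  simp [coord]

/-- The operation `Q_k ⊗ ∪^{(k)}` on `A ⊗ N^•(Δ^n)`, with the Koszul sign from
`(A ⊗ N)^{⊗k} ≅ A^{⊗k} ⊗ N^{⊗k}`. It is written in the basis `φ_I`;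
`QTensorCup_tmul` gives it on pure tensors. For `k = 0` it is `Q₀ ⊗ 1`. -/
noncomputable def QTensorCup (k : ℕ) :
    MultilinearMap K (fun _ : Fin k => A ⊗[K] NCochain K n) (A ⊗[K] NCochain K n) :=
  ∑ I : Fin k → NCochain.Simplex n,
    ((TensorProduct.mk K A (NCochain K n)).flip
        (List.ofFn fun j => NCochain.φ (I j)).prod).compMultilinearMap
      ((𝔸.Q k).compLinearMap fun j =>
        (𝔸.parity ^ ∑ i ∈ Finset.Iio j, (I i).dim) ∘ₗ coord K A (I j).1)

theorem QTensorCup_apply (k : ℕ) (v : Fin k → A ⊗[K] NCochain K n) :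
    𝔸.QTensorCup n k v = ∑ I : Fin k → NCochain.Simplex n,
      𝔸.Q k (fun j => (𝔸.parity ^ ∑ i ∈ Finset.Iio j, (I i).dim) (coord K A (I j).1 (v j))) ⊗ₜ[K]
        (List.ofFn fun j => (NCochain.φ (I j) : NCochain K n)).prod := by
  simp [QTensorCup]

theorem parity_pow_of_mem {p : ℤ} {a : A} (ha : a ∈ 𝔸.gr p) (e : ℕ) :
    (𝔸.parity ^ e) a = (p * e).negOnePow • a := by
  induction e with
  | zero => simp
  | succ e ih =>
    rw [pow_succ', Module.End.mul_apply, ih, Units.smul_def, map_zsmul, 𝔸.parity_of_mem ha,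
      ← Units.smul_def, smul_smul, ← Int.negOnePow_add]
    push_cast
    rw [mul_add, mul_one]

theorem negOnePow_sum {ι : Type*} (s : Finset ι) (w : ι → ℤ) :
    (∑ j ∈ s, w j).negOnePow = ∏ j ∈ s, (w j).negOnePow := by
  classical
  induction s using Finset.induction_on with
  | empty => simp
  | insert a s ha ih => rw [Finset.sum_insert ha, Finset.prod_insert ha, Int.negOnePow_add, ih]

/-- `(Q_k ⊗ ∪^{(k)})(a₁ ⊗ c₁, …, a_k ⊗ c_k) = ± Q_k(a₁, …, a_k) ⊗ (c₁ ∪ ⋯ ∪ c_k)` with the sign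
`(-1)^{∑_{i<j} |a_j| |c_i|}`. -/
theorem QTensorCup_tmul (k : ℕ) (p : Fin k → ℤ) (q : Fin k → ℕ) (a : Fin k → A)
    (c : Fin k → NCochain K n) (ha : ∀ j, a j ∈ 𝔸.gr (p j))
    (hc : ∀ j, c j ∈ NCochain.gr (q j)) :
    𝔸.QTensorCup n k (fun j => a j ⊗ₜ[K] c j) =
      (∑ j, ∑ i ∈ Finset.Iio j, p j * q i).negOnePow • (𝔸.Q k a ⊗ₜ[K] (List.ofFn c).prod) := by
  rw [QTensorCup_apply, NCochain.prod_expand c, TensorProduct.tmul_sum, Finset.smul_sum]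
  refine Finset.sum_congr rfl fun I _ => ?_
  by_cases hz : ∀ j, (I j).1.card = q j + 1
  · have hd : ∀ j, (I j).dim = q j := fun j => by simp [NCochain.Simplex.dim, hz j]
    have : (fun j => (𝔸.parity ^ ∑ i ∈ Finset.Iio j, (I i).dim)
          (coord K A (I j).1 (a j ⊗ₜ[K] c j))) =
        fun j => ((((p j * ∑ i ∈ Finset.Iio j, (q i : ℤ)).negOnePow : ℤ) : K) * c j (I j).1) •
          a j := by
      funext j
      rw [coord_tmul, map_smul, 𝔸.parity_pow_of_mem (ha j)]
      simp only [hd]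
      push_cast
      rw [Units.smul_def, ← Int.cast_smul_eq_zsmul K, smul_smul, mul_comm]
    rw [this, MultilinearMap.map_smul_univ, Finset.prod_mul_distrib, mul_smul,
      ← TensorProduct.smul_tmul', TensorProduct.tmul_smul, ← TensorProduct.smul_tmul',
      Units.smul_def, ← Int.cast_smul_eq_zsmul K]
    congr 1
    rw [← Int.cast_prod]
    congr 1
    simp only [← Finset.mul_sum]
    rw [negOnePow_sum, Units.coe_prod]
  · push Not at hz
    obtain ⟨j, hj⟩ := hz
    have h0 : c j (I j).1 = 0 := hc j _ hj
    rw [Finset.prod_eq_zero (Finset.mem_univ j) h0, zero_smul, TensorProduct.tmul_zero, smul_zero,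
      (𝔸.Q k).map_coord_zero j, TensorProduct.zero_tmul]
    rw [coord_tmul, h0, zero_smul, map_zero]

/-- The structure maps of the extension of scalars `A ⊗ N^•(Δ^n)`: `Q₀ ⊗ 1`,
`Q₁ ⊗ id + id ⊗ d` (where `(id ⊗ d)(a ⊗ c) = (-1)^{|a|} a ⊗ d c`), and `Q_k ⊗ ∪^{(k)}` for `k ≥ 2`. -/
noncomputable def QExt : (k : ℕ) →
    MultilinearMap K (fun _ : Fin k => A ⊗[K] NCochain K n) (A ⊗[K] NCochain K n)
  | 1 => 𝔸.QTensorCup n 1 +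
      MultilinearMap.ofSubsingleton K (A ⊗[K] NCochain K n) (A ⊗[K] NCochain K n) (0 : Fin 1)
        (TensorProduct.map 𝔸.parity NCochain.d)
  | k => 𝔸.QTensorCup n k

/-- The degree `r` part of `A ⊗ N^•(Δ^n)`. -/
noncomputable def grExt (r : ℤ) : Submodule K (A ⊗[K] NCochain K n) :=
  ⨆ (p : ℤ) (q : ℕ) (_ : p + q = r),
    Submodule.map₂ (TensorProduct.mk K A (NCochain K n)) (𝔸.gr p) (NCochain.gr q)

end ShiftedAInfAlgebra

namespace FilteredShiftedAInfAlgebra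

variable (𝔸 : FilteredShiftedAInfAlgebra K A) (n : ℕ)

/-- The filtration `F^k(A ⊗ N^•(Δ^n)) = F^k A ⊗ N^•(Δ^n)`. -/
noncomputable def FExt (k : ℕ) : Submodule K (A ⊗[K] NCochain K n) :=
  Submodule.map₂ (TensorProduct.mk K A (NCochain K n)) (𝔸.F k) ⊤

end FilteredShiftedAInfAlgebra

/-- `x` is a Maurer-Cartan element: it has degree `0` and its curvature, the sum of the series
`∑_{l ≥ 0} Q_l(x, …, x)` in the topology of the filtration, is `0`. -/
def IsMaurerCartan {V : Type*} [AddCommGroup V] [Module K V] (gr : ℤ → Submodule K V)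
    (F : ℕ → Submodule K V) (Q : (l : ℕ) → MultilinearMap K (fun _ : Fin l => V) V)
    (x : V) : Prop :=
  x ∈ gr 0 ∧ ∀ k, ∃ N, ∀ n ≥ N, ∑ l ∈ Finset.range n, Q l (fun _ => x) ∈ F k

namespace FilteredShiftedAInfAlgebra

variable (𝔸 : FilteredShiftedAInfAlgebra K A)

variable (A) in
/-- The map `A ⊗ N^•(Δ^n) → A ⊗ N^•(Δ^m)` induced by a monotone map `[m] → [n]`. -/
noncomputable def pullT {m n : ℕ} (θ : Fin (m + 1) →o Fin (n + 1)) :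
    A ⊗[K] NCochain K n →ₗ[K] A ⊗[K] NCochain K m :=
  LinearMap.lTensor A (NCochain.pull θ).toLinearMap

theorem pullT_id {n : ℕ} (v : A ⊗[K] NCochain K n) : pullT A OrderHom.id v = v := by
  rw [pullT, NCochain.pull_id]
  exact LinearMap.lTensor_id_apply A _ v

theorem pullT_comp {l m n : ℕ} (θ : Fin (m + 1) →o Fin (n + 1)) (η : Fin (l + 1) →o Fin (m + 1))
    (v : A ⊗[K] NCochain K n) : pullT A (θ.comp η) v = pullT A η (pullT A θ v) := by
  induction v with
  | zero => simp
  | add x y hx hy => simp only [map_add, hx, hy]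
  | tmul a c => simp [pullT, NCochain.pull_comp]

theorem coord_pullT {m n : ℕ} (θ : Fin (m + 1) →o Fin (n + 1)) (I : Finset (Fin (m + 1)))
    (v : A ⊗[K] NCochain K n) :
    ShiftedAInfAlgebra.coord K A I (pullT A θ v) =
      if Set.InjOn θ (I : Set (Fin (m + 1))) then
        ShiftedAInfAlgebra.coord K A (I.image θ) v else 0 := by
  induction v with
  | zero => simp
  | add x y hx hy => rw [map_add, map_add, hx, hy]; split_ifs <;> simp
  | tmul a c =>
    simp only [pullT, LinearMap.lTensor_tmul, ShiftedAInfAlgebra.coord_tmul,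
      AlgHom.toLinearMap_apply, NCochain.pull_apply]
    split_ifs <;> simp

theorem pullT_QTensorCup {m n : ℕ} (θ : Fin (m + 1) →o Fin (n + 1)) (k : ℕ)
    (v : Fin k → A ⊗[K] NCochain K n) :
    pullT A θ (𝔸.QTensorCup n k v) = 𝔸.QTensorCup m k (fun j => pullT A θ (v j)) := by
  simp only [ShiftedAInfAlgebra.QTensorCup_apply, map_sum, coord_pullT]
  have hL : ∀ I : Fin k → NCochain.Simplex n, ∀ z : A,
      pullT A θ (z ⊗ₜ[K] (List.ofFn fun j => (NCochain.φ (I j) : NCochain K n)).prod) =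
        ∑ J : Fin k → NCochain.Simplex m,
          ((∏ j, NCochain.pull θ (NCochain.φ (I j) : NCochain K n) (J j).1) • z) ⊗ₜ[K]
            (List.ofFn fun j => (NCochain.φ (J j) : NCochain K m)).prod := by
    intro I z
    rw [pullT, LinearMap.lTensor_tmul, AlgHom.toLinearMap_apply, map_list_prod, List.map_ofFn,
      NCochain.prod_expand, TensorProduct.tmul_sum]
    exact Finset.sum_congr rfl fun J _ => by
      rw [TensorProduct.tmul_smul, TensorProduct.smul_tmul']; rfl
  simp only [hL]
  rw [Finset.sum_comm]
  refine Finset.sum_congr rfl fun J _ => ?_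
  rw [← TensorProduct.sum_tmul]
  congr 1
  by_cases hJ : ∀ j, Set.InjOn θ ((J j).1 : Set (Fin (m + 1)))
  · rw [Finset.sum_eq_single (fun j => (⟨(J j).1.image θ, (J j).2.image θ⟩ : NCochain.Simplex n))]
    · rw [Finset.prod_eq_one, one_smul]
      · congr 1
        funext j
        rw [if_pos (hJ j)]
        simp only [NCochain.Simplex.dim, Finset.card_image_of_injOn (hJ _)]
      · intro j _
        rw [NCochain.pull_apply, if_pos (hJ j), NCochain.φ_apply, if_pos rfl]
    · intro I _ hne
      obtain ⟨j, hj⟩ := Function.ne_iff.1 hne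
      rw [Finset.prod_eq_zero (Finset.mem_univ j), zero_smul]
      rw [NCochain.pull_apply, if_pos (hJ j), NCochain.φ_apply, if_neg]
      intro he
      exact hj (Subtype.ext he.symm)
    · simp
  · push Not at hJ
    obtain ⟨j, hj⟩ := hJ
    rw [(𝔸.Q k).map_coord_zero j (by rw [if_neg hj, map_zero])]
    refine Finset.sum_eq_zero fun I _ => ?_
    rw [Finset.prod_eq_zero (Finset.mem_univ j), zero_smul]
    rw [NCochain.pull_apply, if_neg hj]

theorem pullT_QExt {m n : ℕ} (θ : Fin (m + 1) →o Fin (n + 1)) (k : ℕ)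
    (v : Fin k → A ⊗[K] NCochain K n) :
    pullT A θ (𝔸.QExt n k v) = 𝔸.QExt m k (fun j => pullT A θ (v j)) := by
  match k with
  | 0 => exact 𝔸.pullT_QTensorCup θ 0 v
  | k + 2 => exact 𝔸.pullT_QTensorCup θ (k + 2) v
  | 1 =>
    simp only [ShiftedAInfAlgebra.QExt, add_apply, map_add, pullT_QTensorCup,
      MultilinearMap.ofSubsingleton_apply_apply]
    congr 1
    generalize v 0 = w
    induction w with
    | zero => simp
    | add x y hx hy => simp only [map_add, hx, hy]
    | tmul a c => simp [pullT, NCochain.pull_d]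

theorem pullT_mem_grExt {m n : ℕ} (θ : Fin (m + 1) →o Fin (n + 1)) (r : ℤ)
    {x : A ⊗[K] NCochain K n} (hx : x ∈ 𝔸.grExt n r) : pullT A θ x ∈ 𝔸.grExt m r := by
  have : 𝔸.grExt n r ≤ (𝔸.grExt m r).comap (pullT A θ) := by
    refine iSup_le fun p => iSup_le fun q => iSup_le fun h => ?_
    rw [Submodule.map₂_le]
    intro a ha c hc
    refine Submodule.mem_iSup_of_mem p (Submodule.mem_iSup_of_mem q (Submodule.mem_iSup_of_mem h ?_))
    exact Submodule.apply_mem_map₂ _ ha (NCochain.pull_mem_gr θ hc)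
  exact this hx

theorem pullT_mem_FExt {m n : ℕ} (θ : Fin (m + 1) →o Fin (n + 1)) (k : ℕ)
    {x : A ⊗[K] NCochain K n} (hx : x ∈ 𝔸.FExt n k) : pullT A θ x ∈ 𝔸.FExt m k := by
  have : 𝔸.FExt n k ≤ (𝔸.FExt m k).comap (pullT A θ) := by
    unfold FExt
    rw [Submodule.map₂_le]
    intro a ha c _
    exact Submodule.apply_mem_map₂ _ ha Submodule.mem_top
  exact this hx

theorem pullT_isMaurerCartan {m n : ℕ} (θ : Fin (m + 1) →o Fin (n + 1))
    {x : A ⊗[K] NCochain K n} (hx : IsMaurerCartan (𝔸.grExt n) (𝔸.FExt n) (𝔸.QExt n) x) :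
    IsMaurerCartan (𝔸.grExt m) (𝔸.FExt m) (𝔸.QExt m) (pullT A θ x) := by
  refine ⟨𝔸.pullT_mem_grExt θ 0 hx.1, fun k => ?_⟩
  obtain ⟨N, hN⟩ := hx.2 k
  refine ⟨N, fun n hn => ?_⟩
  have := 𝔸.pullT_mem_FExt θ k (hN n hn)
  rw [map_sum] at this
  simpa only [pullT_QExt] using this

open CategoryTheory in
/-- The Maurer-Cartan simplicial set: its `n`-simplices are the Maurer-Cartan elements of
`A ⊗ N^•(Δ^n)`. -/
noncomputable def MC : SSet.{max u v} where
  obj X := {x : A ⊗[K] NCochain K X.unop.len //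
    IsMaurerCartan (𝔸.grExt _) (𝔸.FExt _) (𝔸.QExt _) x}
  map f := ↾ fun x => ⟨pullT A f.unop.toOrderHom x.1, 𝔸.pullT_isMaurerCartan _ x.2⟩
  map_id X := by
    ext x
    exact pullT_id x.1
  map_comp f g := by
    ext x
    exact pullT_comp _ _ x.1

end FilteredShiftedAInfAlgebra

end Algebras

end AInf

namespace AInf

/-! ### Normalized cochains as a differential graded algebra. -/

namespace NCochain

variable {K : Type*} [Field K] {n : ℕ}

/-! A horn in `Δ^{n+1}` with missing facet `k` prescribes every coordinate of a degree `0` element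
except two: the one at the top simplex and the one at the facet opposite `k`. Put `0` at the top
simplex and an unknown `b` at that facet. The top component of the curvature then has the form
`±parity b` plus a remainder, because `d` sends the dual of a facet to plus or minus the dual of the
top simplex. Its vanishing is a fixed point equation for `b`. The remainder is contracting in the
filtration: `Q 0` gives a constant, `Q 1` sees only the top coordinate, which is `0`, and each `Q l`
with `l ≥ 2` gains at least one step since `F 1` is everything. Completeness yields `b`
(`hornStep_sub_mem`, `exists_coord_univ_curv_mem`). The only coefficient to invert is a sign, so the
characteristic plays no role.

The curvature `r` now vanishes at the top simplex, and on all faces of the horn because curvature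
commutes with restriction. The facet opposite `k` remains. There the Bianchi identity `d r + ∑
Q_l(x, …, r, …, x) = 0`, read at the top simplex, expresses the missing component of `r` through
components that vanish and through terms one filtration step deeper than `r`. Induction on the
filtration and separation give `r = 0` (`isMaurerCartan_of_coord_curv`).

The Bianchi identity rests on two facts about `A ⊗ N`, both with Koszul signs: the operations `Q_k ⊗
∪` satisfy the `A_∞`-relations by associativity of the cup product (`sum_insertComp_QTensorCup`),
and `id ⊗ d` is a derivation of them by the Leibniz rule (`dExt_QTensorCup`). Both are needed only
at elements of degree `0`. The infinite series enters only through its partial sums, so every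
identity is stated modulo a step of the filtration. -/

theorem d_one : d (1 : NCochain K n) = 0 := by
  ext I
  rw [d_apply, zero_apply]
  by_cases hI : I.card = 2
  · obtain ⟨a, b, hab, rfl⟩ := Finset.card_eq_two.1 hI
    have hp : ∀ x y : Fin (n + 1), x < y →
        ∑ i ∈ ({x, y} : Finset (Fin (n + 1))), (-1 : K) ^ (({x, y} : Finset _).filter (· < i)).card *
          (1 : NCochain K n) (({x, y} : Finset _).erase i) = 0 := by
      intro x y h
      have e1 : ({x, y} : Finset (Fin (n + 1))).filter (· < x) = ∅ := by
        ext z; simp; rintro (rfl | rfl) <;> order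
      have e2 : ({x, y} : Finset (Fin (n + 1))).filter (· < y) = {x} := by
        ext z; simp; constructor
        · rintro ⟨rfl | rfl, h2⟩
          · rfl
          · order
        · rintro rfl; exact ⟨Or.inl rfl, h⟩
      have e3 : ∀ z ∈ ({x, y} : Finset (Fin (n + 1))), (({x, y} : Finset _).erase z).card = 1 := by
        intro z hz
        rw [Finset.card_erase_of_mem hz, Finset.card_pair h.ne]
      rw [Finset.sum_pair h.ne, one_apply, one_apply, e3 x (by simp), e3 y (by simp), e1, e2]
      simp
    rcases lt_or_gt_of_ne hab with h | h
    · exact hp a b h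
    · rw [Finset.pair_comm]; exact hp b a h
  · refine Finset.sum_eq_zero fun i hi => ?_
    rw [one_apply, if_neg, mul_zero]
    rw [Finset.card_erase_of_mem hi]
    omega

/-- Two vertices can be deleted in either order, and the signs are opposite: once the smaller vertex
is gone, the position of the larger one drops by one. -/
theorem d_d (f : NCochain K n) : d (d f) = 0 := by
  ext I
  simp only [d_apply, zero_apply, Finset.mul_sum]
  rw [Finset.sum_sigma']
  refine Finset.sum_involution (fun x _ => ⟨x.2, x.1⟩) ?_ ?_ ?_ ?_
  · rintro ⟨i, j⟩ hx
    simp only [Finset.mem_sigma, Finset.mem_erase] at hx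
    obtain ⟨hi, hji, hj⟩ := hx
    have key : ∀ x y : Fin (n + 1), x ∈ I → x < y →
        (-1 : K) ^ (I.filter (· < x)).card * ((-1) ^ ((I.erase x).filter (· < y)).card
          * f ((I.erase x).erase y)) +
        (-1 : K) ^ (I.filter (· < y)).card * ((-1) ^ ((I.erase y).filter (· < x)).card
          * f ((I.erase y).erase x)) = 0 := by
      intro x y hx hxy
      have e1 : (I.erase y).filter (· < x) = I.filter (· < x) := by
        ext z; simp only [Finset.mem_filter, Finset.mem_erase]
        exact ⟨fun h => ⟨h.1.2, h.2⟩, fun h => ⟨⟨(h.2.trans hxy).ne, h.1⟩, h.2⟩⟩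
      have e2 : (I.filter (· < y)).card = ((I.erase x).filter (· < y)).card + 1 := by
        rw [Finset.filter_erase, Finset.card_erase_of_mem (by simp [hx, hxy])]
        have : 0 < (I.filter (· < y)).card := Finset.card_pos.2 ⟨x, by simp [hx, hxy]⟩
        omega
      rw [e1, e2, Finset.erase_right_comm]
      ring
    rcases lt_or_gt_of_ne hji with h | h
    · rw [add_comm]; exact key j i hj h
    · exact key i j hi h
  · rintro ⟨i, j⟩ hx _ he
    simp only [Finset.mem_sigma, Finset.mem_erase] at hx
    simp only [Sigma.mk.injEq] at he
    exact hx.2.1 he.1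
  · rintro ⟨i, j⟩ hx
    simp only [Finset.mem_sigma, Finset.mem_erase] at hx ⊢
    exact ⟨hx.2.2, hx.2.1.symm, hx.1⟩
  · rintro ⟨i, j⟩ hx; rfl

/-- The cuts of a finite chain into an initial and a final segment, enumerated in two ways: by the
first element of the final segment and by the last element of the initial segment. -/
theorem sum_cuts {α M : Type*} [LinearOrder α] [AddCommMonoid M] (I : Finset α)
    (G : Finset α → Finset α → M) :
    ∑ j ∈ I, G (I.filter (· < j)) (I.filter (j ≤ ·)) + G I ∅ =
      ∑ j ∈ I, G (I.filter (· ≤ j)) (I.filter (j < ·)) + G ∅ I := by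
  induction I using Finset.induction_on_max generalizing G with
  | empty => simp
  | insert m I hm ih =>
    have hmI : m ∉ I := fun h => (hm m h).false
    rw [Finset.sum_insert hmI, Finset.sum_insert hmI]
    have e1 : (insert m I).filter (· < m) = I := by
      ext z; simp only [Finset.mem_filter, Finset.mem_insert]
      exact ⟨fun h => h.1.resolve_left h.2.ne, fun h => ⟨Or.inr h, hm z h⟩⟩
    have e2 : (insert m I).filter (m ≤ ·) = {m} := by
      ext z; simp only [Finset.mem_filter, Finset.mem_insert, Finset.mem_singleton]
      exact ⟨fun h => h.1.resolve_right fun hz => (hm z hz).not_ge h.2,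
        fun h => ⟨Or.inl h, h.ge⟩⟩
    have e3 : (insert m I).filter (· ≤ m) = insert m I := by
      refine Finset.filter_true_of_mem fun z hz => ?_
      rcases Finset.mem_insert.1 hz with rfl | h
      · exact le_rfl
      · exact (hm z h).le
    have e4 : (insert m I).filter (m < ·) = ∅ := by
      refine Finset.filter_false_of_mem fun z hz => ?_
      rcases Finset.mem_insert.1 hz with rfl | h
      · exact lt_irrefl _
      · exact (hm z h).not_gt
    rw [e1, e2, e3, e4]
    have s1 : ∑ j ∈ I, G ((insert m I).filter (· < j)) ((insert m I).filter (j ≤ ·)) =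
        ∑ j ∈ I, G (I.filter (· < j)) (insert m (I.filter (j ≤ ·))) := by
      refine Finset.sum_congr rfl fun j hj => ?_
      rw [Finset.filter_insert, Finset.filter_insert, if_neg (hm j hj).not_gt, if_pos (hm j hj).le]
    have s2 : ∑ j ∈ I, G ((insert m I).filter (· ≤ j)) ((insert m I).filter (j < ·)) =
        ∑ j ∈ I, G (I.filter (· ≤ j)) (insert m (I.filter (j < ·))) := by
      refine Finset.sum_congr rfl fun j hj => ?_
      rw [Finset.filter_insert, Finset.filter_insert, if_neg (hm j hj).not_ge, if_pos (hm j hj)]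
    have := ih fun L U => G L (insert m U)
    simp only [insert_empty_eq] at this
    rw [s1, s2, add_comm (G I {m}), this]
    abel

/-- Both sides are sums over a deleted vertex `i` and a cut vertex `j`. The terms with `i ≠ j`
match. The terms with `i = j` occur only on the right, and they cancel between the two products
because a cut after one vertex is a cut before the next (`sum_cuts`). -/
theorem d_mul {q : ℕ} {f : NCochain K n} (hf : f ∈ gr (K := K) q) (g : NCochain K n) :
    d (f * g) = d f * g + (-1 : K) ^ q • (f * d g) := by
  ext I
  rw [add_apply, smul_apply]
  simp only [d_apply, mul_apply, Finset.mul_sum, Finset.sum_mul]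
  have hL : ∀ i ∈ I, ∑ j ∈ I.erase i, (-1 : K) ^ (I.filter (· < i)).card *
        (f ((I.erase i).filter (· ≤ j)) * g ((I.erase i).filter (j ≤ ·))) =
      ∑ j ∈ I.filter (i < ·), (-1 : K) ^ (I.filter (· < i)).card *
        f ((I.filter (· ≤ j)).erase i) * g (I.filter (j ≤ ·)) +
      ∑ j ∈ I.filter (· < i), (-1 : K) ^ q * (f (I.filter (· ≤ j)) *
        ((-1) ^ ((I.filter (j ≤ ·)).filter (· < i)).card * g ((I.filter (j ≤ ·)).erase i))) := by
    intro i hi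
    have hs : I.erase i = I.filter (i < ·) ∪ I.filter (· < i) := by
      ext z; simp only [Finset.mem_erase, Finset.mem_union, Finset.mem_filter]
      constructor
      · rintro ⟨h1, h2⟩
        rcases lt_or_gt_of_ne h1 with h | h
        · exact Or.inr ⟨h2, h⟩
        · exact Or.inl ⟨h2, h⟩
      · rintro (h | h)
        · exact ⟨h.2.ne', h.1⟩
        · exact ⟨h.2.ne, h.1⟩
    have hdis : Disjoint (I.filter (i < ·)) (I.filter (· < i)) := by
      rw [Finset.disjoint_left]; intro z; simp only [Finset.mem_filter]
      rintro ⟨-, h⟩ ⟨-, h'⟩; exact h.not_gt h'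
    rw [Finset.sum_congr hs fun _ _ => rfl, Finset.sum_union hdis]
    congr 1
    · refine Finset.sum_congr rfl fun j hj => ?_
      simp only [Finset.mem_filter] at hj
      rw [Finset.filter_erase, Finset.filter_erase, Finset.erase_eq_of_notMem
        (s := I.filter (j ≤ ·)) (by simp [hj.2]), mul_assoc]
    · refine Finset.sum_congr rfl fun j hj => ?_
      simp only [Finset.mem_filter] at hj
      rw [Finset.filter_erase, Finset.filter_erase, Finset.erase_eq_of_notMem
        (s := I.filter (· ≤ j)) (by simp [hj.2])]
      -- The sign identity needs the front face to have dimension `q`; otherwise `f` vanishes on it.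
      by_cases hc : (I.filter (· ≤ j)).card = q + 1
      · have e : (I.filter (· < i)).card = q + ((I.filter (j ≤ ·)).filter (· < i)).card := by
          have h1 : I.filter (· < i) =
              (I.filter (· ≤ j)).erase j ∪ (I.filter (j ≤ ·)).filter (· < i) := by
            ext z; simp only [Finset.mem_erase, Finset.mem_union, Finset.mem_filter]
            constructor
            · rintro ⟨h1, h2⟩
              rcases lt_or_ge z j with h | h
              · exact Or.inl ⟨h.ne, h1, h.le⟩
              · exact Or.inr ⟨⟨h1, h⟩, h2⟩
            · rintro (h | h)
              · exact ⟨h.2.1, h.2.2.trans_lt hj.2⟩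
              · exact ⟨h.1.1, h.2⟩
          rw [h1, Finset.card_union_of_disjoint, Finset.card_erase_of_mem (by simp [hj.1]), hc]
          · simp
          · rw [Finset.disjoint_left]; intro z
            simp only [Finset.mem_filter, Finset.mem_erase]
            rintro ⟨h1, -, h2⟩ ⟨⟨-, h3⟩, -⟩; exact h1 (le_antisymm h2 h3)
        rw [e]; ring
      · rw [hf _ hc]; ring
  rw [Finset.sum_congr rfl hL, Finset.sum_add_distrib]
  have hA : ∀ j ∈ I, ∑ i ∈ I.filter (· ≤ j), (-1 : K) ^ ((I.filter (· ≤ j)).filter (· < i)).card *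
        f ((I.filter (· ≤ j)).erase i) * g (I.filter (j ≤ ·)) =
      ∑ i ∈ I.filter (· < j), (-1 : K) ^ (I.filter (· < i)).card *
        f ((I.filter (· ≤ j)).erase i) * g (I.filter (j ≤ ·)) +
      (-1 : K) ^ (q + 1) * (f (I.filter (· < j)) * g (I.filter (j ≤ ·))) := by
    intro j hj
    have hs : I.filter (· ≤ j) = insert j (I.filter (· < j)) := by
      ext z; simp only [Finset.mem_insert, Finset.mem_filter]
      constructor
      · rintro ⟨h1, h2⟩
        rcases h2.eq_or_lt with h | h
        · exact Or.inl h
        · exact Or.inr ⟨h1, h⟩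
      · rintro (rfl | h)
        · exact ⟨hj, le_rfl⟩
        · exact ⟨h.1, h.2.le⟩
    have hjn : j ∉ I.filter (· < j) := by simp
    have hff : ∀ i ≤ j, (I.filter (· ≤ j)).filter (· < i) = I.filter (· < i) := by
      intro i hi
      rw [Finset.filter_filter]
      exact Finset.filter_congr fun z _ => ⟨fun h => h.2, fun h => ⟨h.le.trans hi, h⟩⟩
    rw [Finset.sum_congr hs fun _ _ => rfl, Finset.sum_insert hjn, add_comm]
    congr 1
    · refine Finset.sum_congr rfl fun i hi => ?_
      rw [hff i (Finset.mem_filter.1 hi).2.le]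
    · rw [hff j le_rfl, hs, Finset.erase_insert hjn]
      by_cases hc : (I.filter (· < j)).card = q + 1
      · rw [hc]; ring
      · rw [hf _ hc]; ring
  have hB : ∀ j ∈ I, ∑ i ∈ I.filter (j ≤ ·), (-1 : K) ^ q * (f (I.filter (· ≤ j)) *
        ((-1) ^ ((I.filter (j ≤ ·)).filter (· < i)).card * g ((I.filter (j ≤ ·)).erase i))) =
      ∑ i ∈ I.filter (j < ·), (-1 : K) ^ q * (f (I.filter (· ≤ j)) *
        ((-1) ^ ((I.filter (j ≤ ·)).filter (· < i)).card * g ((I.filter (j ≤ ·)).erase i))) +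
      (-1 : K) ^ q * (f (I.filter (· ≤ j)) * g (I.filter (j < ·))) := by
    intro j hj
    have hs : I.filter (j ≤ ·) = insert j (I.filter (j < ·)) := by
      ext z; simp only [Finset.mem_insert, Finset.mem_filter]
      constructor
      · rintro ⟨h1, h2⟩
        rcases h2.eq_or_lt with h | h
        · exact Or.inl h.symm
        · exact Or.inr ⟨h1, h⟩
      · rintro (rfl | h)
        · exact ⟨hj, le_rfl⟩
        · exact ⟨h.1, h.2.le⟩
    have hjn : j ∉ I.filter (j < ·) := by simp
    rw [Finset.sum_congr hs fun _ _ => rfl, Finset.sum_insert hjn, add_comm]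
    congr 1
    have : (I.filter (j ≤ ·)).filter (· < j) = ∅ := by
      rw [Finset.filter_filter]
      exact Finset.filter_false_of_mem fun z _ h => h.1.not_gt h.2
    rw [this, hs, Finset.erase_insert hjn]
    simp
  rw [Finset.sum_congr rfl hA, Finset.sum_congr rfl hB, Finset.sum_add_distrib,
    Finset.sum_add_distrib, ← Finset.mul_sum, ← Finset.mul_sum]
  have hcut := sum_cuts I fun L U => f L * g U
  -- The two extreme cuts drop out because cochains vanish at the empty set.
  simp only [apply_empty, mul_zero, zero_mul, add_zero] at hcut
  rw [hcut]
  have hsw1 : ∑ i ∈ I, ∑ j ∈ I.filter (i < ·), (-1 : K) ^ (I.filter (· < i)).card *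
        f ((I.filter (· ≤ j)).erase i) * g (I.filter (j ≤ ·)) =
      ∑ j ∈ I, ∑ i ∈ I.filter (· < j), (-1 : K) ^ (I.filter (· < i)).card *
        f ((I.filter (· ≤ j)).erase i) * g (I.filter (j ≤ ·)) :=
    Finset.sum_comm' (by intro x y; simp only [Finset.mem_filter]; tauto)
  have hsw2 : ∑ i ∈ I, ∑ j ∈ I.filter (· < i), (-1 : K) ^ q * (f (I.filter (· ≤ j)) *
        ((-1) ^ ((I.filter (j ≤ ·)).filter (· < i)).card * g ((I.filter (j ≤ ·)).erase i))) =
      ∑ j ∈ I, ∑ i ∈ I.filter (j < ·), (-1 : K) ^ q * (f (I.filter (· ≤ j)) *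
        ((-1) ^ ((I.filter (j ≤ ·)).filter (· < i)).card * g ((I.filter (j ≤ ·)).erase i))) :=
    Finset.sum_comm' (by intro x y; simp only [Finset.mem_filter]; tauto)
  rw [hsw1, hsw2]
  ring

theorem mul_mem_gr {p q : ℕ} {f g : NCochain K n} (hf : f ∈ gr (K := K) p)
    (hg : g ∈ gr (K := K) q) : f * g ∈ gr (K := K) (p + q) := by
  intro I hI
  rw [mul_apply]
  refine Finset.sum_eq_zero fun i hi => ?_
  by_contra hne
  have h1 : (I.filter (· ≤ i)).card = p + 1 := by
    by_contra h; exact hne (by rw [hf _ h, zero_mul])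
  have h2 : (I.filter (i ≤ ·)).card = q + 1 := by
    by_contra h; exact hne (by rw [hg _ h, mul_zero])
  have hu : I.filter (· ≤ i) ∪ I.filter (i ≤ ·) = I := by
    rw [← Finset.filter_or]
    exact Finset.filter_true_of_mem fun z _ => le_total z i
  have hin : I.filter (· ≤ i) ∩ I.filter (i ≤ ·) = {i} := by
    ext z; simp only [Finset.mem_inter, Finset.mem_filter, Finset.mem_singleton]
    exact ⟨fun h => le_antisymm h.1.2 h.2.2, fun h => by subst h; simp [hi]⟩
  -- Front and back face share exactly the vertex `i`, so dimensions add.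
  have := Finset.card_union_add_card_inter (I.filter (· ≤ i)) (I.filter (i ≤ ·))
  rw [hu, hin, Finset.card_singleton, h1, h2] at this
  omega

theorem one_mem_gr : (1 : NCochain K n) ∈ gr (K := K) 0 := by
  intro I hI
  rw [one_apply, if_neg (by simpa using hI)]

theorem d_mem_gr {q : ℕ} {f : NCochain K n} (hf : f ∈ gr (K := K) q) :
    d f ∈ gr (K := K) (q + 1) := by
  intro I hI
  rw [d_apply]
  refine Finset.sum_eq_zero fun i hi => ?_
  have := Finset.card_pos.2 ⟨i, hi⟩
  rw [hf, mul_zero]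
  rw [Finset.card_erase_of_mem hi]
  omega

theorem φ_mem_gr (I : Simplex n) : (φ I : NCochain K n) ∈ gr (K := K) I.dim := by
  intro J hJ
  rw [φ_apply, if_neg]
  rintro rfl
  have := Finset.card_pos.2 I.2
  simp only [Simplex.dim] at hJ
  omega

theorem prod_map_range_mem_gr (c : ℕ → NCochain K n) (q : ℕ → ℕ) (k : ℕ)
    (hc : ∀ i < k, c i ∈ gr (K := K) (q i)) :
    ((List.range k).map c).prod ∈ gr (K := K) (∑ i ∈ Finset.range k, q i) := by
  induction k with
  | zero => simpa using one_mem_gr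
  | succ k ih =>
    rw [List.range_succ, List.map_append, List.prod_append, Finset.sum_range_succ]
    refine mul_mem_gr (ih fun i hi => hc i (by omega)) ?_
    simpa using hc k (by omega)

theorem d_prod_map_range (c : ℕ → NCochain K n) (q : ℕ → ℕ) (k : ℕ)
    (hc : ∀ i < k, c i ∈ gr (K := K) (q i)) :
    d ((List.range k).map c).prod = ∑ j ∈ Finset.range k,
      (-1 : K) ^ (∑ i ∈ Finset.range j, q i) •
        ((List.range k).map (Function.update c j (d (c j)))).prod := by
  induction k with
  | zero => simpa using d_one
  | succ k ih =>
    have hp := prod_map_range_mem_gr c q k fun i hi => hc i (by omega)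
    rw [List.range_succ, List.map_append, List.prod_append, d_mul hp, ih fun i hi => hc i (by omega),
      Finset.sum_range_succ, Finset.sum_mul]
    congr 1
    · refine Finset.sum_congr rfl fun j hj => ?_
      have : k ≠ j := by have := Finset.mem_range.1 hj; omega
      simp [this]
    · have : (List.range k).map (Function.update c k (d (c k))) = (List.range k).map c := by
        refine List.map_congr_left fun i hi => ?_
        have : i ≠ k := by have := List.mem_range.1 hi; omega
        simp [this]
      simp [this]

end NCochain

/-! ### Coordinates, degrees and filtration on `A ⊗ N^•(Δ^n)`. -/

section

variable {K : Type v} [Field K] {A : Type u} [AddCommGroup A] [Module K A] {n : ℕ}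

namespace ShiftedAInfAlgebra

@[simp] theorem coord_empty (v : A ⊗[K] NCochain K n) : coord K A ∅ v = 0 := by
  induction v with
  | zero => simp
  | add x y hx hy => rw [map_add, hx, hy, add_zero]
  | tmul a c => simp [coord_tmul]

variable (K) in
/-- The element of `A ⊗ N^•(Δ^n)` with prescribed coordinates on the nonempty simplices. -/
noncomputable def ofCoord (w : Finset (Fin (n + 1)) → A) : A ⊗[K] NCochain K n :=
  ∑ I : NCochain.Simplex n, w I.1 ⊗ₜ NCochain.φ I

theorem coord_ofCoord (w : Finset (Fin (n + 1)) → A) {I : Finset (Fin (n + 1))}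
    (hI : I.Nonempty) : coord K A I (ofCoord K w) = w I := by
  rw [ofCoord, map_sum, Finset.sum_eq_single ⟨I, hI⟩]
  · simp [coord_tmul, NCochain.φ_apply]
  · intro J _ hne
    rw [coord_tmul, NCochain.φ_apply, if_neg, zero_smul]
    rintro rfl; exact hne rfl
  · simp

theorem ofCoord_coord (v : A ⊗[K] NCochain K n) : ofCoord K (fun I => coord K A I v) = v := by
  unfold ofCoord
  induction v with
  | zero => simp
  | add x y hx hy => simp only [map_add, TensorProduct.add_tmul, Finset.sum_add_distrib, hx, hy]
  | tmul a c =>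
    simp only [coord_tmul]
    conv_rhs => rw [← NCochain.sum_φ c, TensorProduct.tmul_sum]
    exact Finset.sum_congr rfl fun I _ => by rw [TensorProduct.smul_tmul]

theorem coord_ext {v w : A ⊗[K] NCochain K n}
    (h : ∀ I : Finset (Fin (n + 1)), I.Nonempty → coord K A I v = coord K A I w) : v = w := by
  rw [← ofCoord_coord v, ← ofCoord_coord w, ofCoord, ofCoord]
  exact Finset.sum_congr rfl fun I _ => by rw [h I.1 I.2]

variable (𝔸 : ShiftedAInfAlgebra K A)

variable (n) in
/-- The operator `id ⊗ d` on `A ⊗ N^•(Δ^n)`, with its Koszul sign. -/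
noncomputable abbrev dExt : A ⊗[K] NCochain K n →ₗ[K] A ⊗[K] NCochain K n :=
  TensorProduct.map 𝔸.parity NCochain.d

theorem coord_dExt (I : Finset (Fin (n + 1))) (v : A ⊗[K] NCochain K n) :
    coord K A I (𝔸.dExt n v) =
      ∑ i ∈ I, (-1 : K) ^ (I.filter (· < i)).card • 𝔸.parity (coord K A (I.erase i) v) := by
  induction v with
  | zero => simp
  | add x y hx hy => simp only [map_add, hx, hy, smul_add, Finset.sum_add_distrib]
  | tmul a c =>
    simp only [TensorProduct.map_tmul, coord_tmul, NCochain.d_apply, Finset.sum_smul, map_smul,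
      smul_smul]

theorem parity_parity (a : A) : 𝔸.parity (𝔸.parity a) = a := by
  have ha : a ∈ ⨆ p, 𝔸.gr p := by
    rw [𝔸.isInternal.submodule_iSup_eq_top]; trivial
  induction ha using Submodule.iSup_induction' with
  | mem p x hx =>
    rw [𝔸.parity_of_mem hx, Units.smul_def, map_zsmul, 𝔸.parity_of_mem hx, ← Units.smul_def,
      smul_smul, Int.units_mul_self, one_smul]
  | zero => simp
  | add x y _ _ hx hy => rw [map_add, map_add, hx, hy]

/-- The dual of `I` has degree `I.card - 1`, so the coefficient carries the rest of the degree. This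
reduces all questions of degree to coordinates. -/
theorem mem_grExt_iff (r : ℤ) (v : A ⊗[K] NCochain K n) :
    v ∈ 𝔸.grExt n r ↔ ∀ I : Finset (Fin (n + 1)), I.Nonempty →
      coord K A I v ∈ 𝔸.gr (r + 1 - I.card) := by
  constructor
  · intro hv I _
    have : 𝔸.grExt n r ≤ (𝔸.gr (r + 1 - I.card)).comap (coord K A I) := by
      refine iSup_le fun p => iSup_le fun q => iSup_le fun h => ?_
      rw [Submodule.map₂_le]
      intro a ha c hc
      rw [Submodule.mem_comap, TensorProduct.mk_apply, coord_tmul]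
      by_cases hI : I.card = q + 1
      · have : r + 1 - (I.card : ℤ) = p := by rw [hI]; push_cast; omega
        rw [this]
        exact Submodule.smul_mem _ _ ha
      · rw [hc _ hI, zero_smul]; exact Submodule.zero_mem _
    exact this hv
  · intro h
    rw [← ofCoord_coord v]
    refine Submodule.sum_mem _ fun I _ => ?_
    have hI := Finset.card_pos.2 I.2
    refine Submodule.mem_iSup_of_mem (r + 1 - I.1.card) (Submodule.mem_iSup_of_mem I.dim
      (Submodule.mem_iSup_of_mem ?_ (Submodule.apply_mem_map₂ _ (h I.1 I.2) (NCochain.φ_mem_gr I))))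
    simp only [NCochain.Simplex.dim]; omega

/-- `Q 1` need not raise the filtration, so its contribution has to be controlled coordinate by
coordinate; this is possible because it acts on the coefficients alone. -/
theorem coord_QTensorCup_one (v : Fin 1 → A ⊗[K] NCochain K n) {J : Finset (Fin (n + 1))}
    (hJ : J.Nonempty) :
    coord K A J (𝔸.QTensorCup n 1 v) = 𝔸.Q 1 fun j => coord K A J (v j) := by
  rw [QTensorCup_apply, map_sum, Finset.sum_eq_single fun _ => ⟨J, hJ⟩]
  · rw [coord_tmul]
    simp only [List.ofFn_succ, List.ofFn_zero, List.prod_cons, List.prod_nil, mul_one,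
      NCochain.φ_apply, if_true, one_smul]
    congr 1
    funext j
    have : Finset.Iio j = ∅ := by
      ext i; simp [Subsingleton.elim i j]
    simp [this]
  · intro I _ hne
    rw [coord_tmul]
    simp only [List.ofFn_succ, List.ofFn_zero, List.prod_cons, List.prod_nil, mul_one,
      NCochain.φ_apply]
    rw [if_neg, zero_smul]
    intro h
    apply hne
    funext j
    rw [Subsingleton.elim j 0]
    exact Subtype.ext h.symm
  · simp

end ShiftedAInfAlgebra

namespace FilteredShiftedAInfAlgebra

open ShiftedAInfAlgebra

variable (𝔸 : FilteredShiftedAInfAlgebra K A)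

/-- The filtration is by graded subspaces, and on a homogeneous element `parity` is a sign. -/
theorem parity_mem_F {k : ℕ} {a : A} (ha : a ∈ 𝔸.F k) : 𝔸.parity a ∈ 𝔸.F k := by
  have : (⨆ p, 𝔸.F k ⊓ 𝔸.gr p) ≤ (𝔸.F k).comap 𝔸.parity := by
    refine iSup_le fun p a ha => ?_
    rw [Submodule.mem_comap, 𝔸.parity_of_mem ha.2, Units.smul_def]
    exact zsmul_mem ha.1 _
  exact this (𝔸.F_homogeneous k ha)

theorem parity_mem_F_iff {k : ℕ} {a : A} : 𝔸.parity a ∈ 𝔸.F k ↔ a ∈ 𝔸.F k :=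
  ⟨fun h => 𝔸.parity_parity a ▸ 𝔸.parity_mem_F h, 𝔸.parity_mem_F⟩

theorem parity_pow_mem_F {k : ℕ} {a : A} (ha : a ∈ 𝔸.F k) (e : ℕ) :
    (𝔸.parity ^ e) a ∈ 𝔸.F k := by
  induction e with
  | zero => simpa
  | succ e ih => rw [pow_succ', Module.End.mul_apply]; exact 𝔸.parity_mem_F ih

theorem mem_FExt_iff {k : ℕ} {v : A ⊗[K] NCochain K n} :
    v ∈ 𝔸.FExt n k ↔ ∀ I : Finset (Fin (n + 1)), I.Nonempty → coord K A I v ∈ 𝔸.F k := by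
  constructor
  · intro hv I _
    have : 𝔸.FExt n k ≤ (𝔸.F k).comap (coord K A I) := by
      unfold FExt
      rw [Submodule.map₂_le]
      intro a ha c _
      rw [Submodule.mem_comap, TensorProduct.mk_apply, coord_tmul]
      exact Submodule.smul_mem _ _ ha
    exact this hv
  · intro h
    rw [← ofCoord_coord v]
    exact Submodule.sum_mem _ fun I _ =>
      Submodule.apply_mem_map₂ _ (h I.1 I.2) Submodule.mem_top

theorem coord_mem_F {k : ℕ} {v : A ⊗[K] NCochain K n} (hv : v ∈ 𝔸.FExt n k)
    (I : Finset (Fin (n + 1))) : coord K A I v ∈ 𝔸.F k := by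
  rcases I.eq_empty_or_nonempty with rfl | hI
  · simp
  · exact 𝔸.mem_FExt_iff.1 hv I hI

theorem mem_FExt_one (v : A ⊗[K] NCochain K n) : v ∈ 𝔸.FExt n 1 := by
  rw [mem_FExt_iff, 𝔸.F_one]
  exact fun _ _ => Submodule.mem_top

theorem FExt_antitone : Antitone (𝔸.FExt n) := fun _ _ h _ hv =>
  𝔸.mem_FExt_iff.2 fun I hI => 𝔸.F_antitone h (𝔸.mem_FExt_iff.1 hv I hI)

theorem QTensorCup_mem_FExt (l : ℕ) (k : Fin l → ℕ) (v : Fin l → A ⊗[K] NCochain K n)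
    (hv : ∀ j, v j ∈ 𝔸.FExt n (k j)) : 𝔸.QTensorCup n l v ∈ 𝔸.FExt n (∑ j, k j) := by
  rw [QTensorCup_apply]
  exact Submodule.sum_mem _ fun I _ => Submodule.apply_mem_map₂ _
    (𝔸.Q_mem_F l k _ fun j => 𝔸.parity_pow_mem_F (𝔸.coord_mem_F (hv j) _) _) Submodule.mem_top

/-- Every argument lies in step `1`, so arity alone bounds the filtration from below. Hence the
curvature series is Cauchy. -/
theorem QTensorCup_mem_FExt_length (l : ℕ) (v : Fin l → A ⊗[K] NCochain K n) :
    𝔸.QTensorCup n l v ∈ 𝔸.FExt n l := by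
  simpa using 𝔸.QTensorCup_mem_FExt l (fun _ => 1) v fun j => 𝔸.mem_FExt_one (v j)

/-- The other `l - 1` arguments each contribute one step. For `l ≥ 2` this is the strict gain behind
both the contraction and the Bianchi induction. -/
theorem QTensorCup_update_mem_FExt (l : ℕ) (v : Fin l → A ⊗[K] NCochain K n) (j : Fin l) {k : ℕ}
    {y : A ⊗[K] NCochain K n} (hy : y ∈ 𝔸.FExt n k) :
    𝔸.QTensorCup n l (Function.update v j y) ∈ 𝔸.FExt n (l - 1 + k) := by
  have := 𝔸.QTensorCup_mem_FExt l (Function.update (fun _ => 1) j k) (Function.update v j y) (by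
    intro i
    rcases eq_or_ne i j with rfl | h
    · simpa using hy
    · simpa [h] using 𝔸.mem_FExt_one (v i))
  rw [Finset.sum_update_of_mem (Finset.mem_univ j)] at this
  simp only [Finset.sum_const, smul_eq_mul, mul_one, Finset.card_sdiff, Finset.inter_univ,
    Finset.card_singleton, Finset.card_univ, Fintype.card_fin] at this
  rwa [add_comm]

end FilteredShiftedAInfAlgebra

end

/-! ### The `A_∞`-relations for `Q_k ⊗ ∪^{(k)}`. -/

section

/-- The value `w` is an arbitrary placeholder; in this form multilinearity applies to the inserted
slot. -/
theorem insertAt_eq_update {A : Type*} (a : ℕ → A) (s b t : ℕ) (z w : A) :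
    (fun i : Fin (s + 1 + t) => insertAt a s b z i) =
      Function.update (fun i : Fin (s + 1 + t) => insertAt a s b w i) ⟨s, by omega⟩ z := by
  funext i
  rcases eq_or_ne i ⟨s, by omega⟩ with rfl | h
  · simp [insertAt]
  · have : (i : ℕ) ≠ s := fun hi => h (Fin.ext hi)
    rw [Function.update_of_ne h]
    simp [insertAt, this]

theorem insertAt_const {A : Type*} (x : A) (s b t : ℕ) (z : A) :
    (fun i : Fin (s + 1 + t) => insertAt (fun _ => x) s b z i) =
      Function.update (fun _ => x) ⟨s, by omega⟩ z := by
  funext i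
  rcases eq_or_ne i ⟨s, by omega⟩ with rfl | h
  · simp [insertAt]
  · have : (i : ℕ) ≠ s := fun hi => h (Fin.ext hi)
    rw [Function.update_of_ne h]
    simp [insertAt, this]

variable {K : Type v} [Field K] {A : Type u} [AddCommGroup A] [Module K A] {n : ℕ}

/-- A finite sequence, continued by zeros. -/
def extendZero {k : ℕ} (v : Fin k → A) (i : ℕ) : A := if h : i < k then v ⟨i, h⟩ else 0

theorem extendZero_val {k : ℕ} (v : Fin k → A) (i : Fin k) : extendZero v i = v i := by
  simp [extendZero]

theorem extendZero_update {k : ℕ} (v : Fin k → A) (i : Fin k) (z : A) :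
    extendZero (Function.update v i z) = Function.update (extendZero v) i z := by
  funext j
  rcases eq_or_ne j i with rfl | h
  · simp [extendZero]
  · rw [Function.update_of_ne h]
    unfold extendZero
    split_ifs with hj
    · rw [Function.update_of_ne]
      exact fun he => h (congrArg Fin.val he)
    · rfl

/-- The composition `P_{s+1+t} ∘ (id^{⊗s} ⊗ R_b ⊗ id^{⊗t})` as a function on sequences. -/
def insertComp (P R : (k : ℕ) → MultilinearMap K (fun _ : Fin k => A) A) (s b t : ℕ)
    (a : ℕ → A) : A :=
  P (s + 1 + t) fun i => insertAt a s b (R b fun j => a (s + j)) i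

/-- In one variable, `insertComp` is a linear map. -/
theorem exists_insertComp_update (P R : (k : ℕ) → MultilinearMap K (fun _ : Fin k => A) A)
    (s b t : ℕ) (a : ℕ → A) (i : ℕ) (hi : i < s + b + t) :
    ∃ f : A →ₗ[K] A, ∀ z, insertComp P R s b t (Function.update a i z) = f z := by
  -- The variable lies before the block, inside it, or after it; in the last case it occupies slot
  -- `i + 1 - b` of the outer operation.
  rcases lt_or_ge i s with h1 | h1
  · refine ⟨(P (s + 1 + t)).toLinearMap (fun j => insertAt a s b (R b fun j => a (s + j)) j)
      ⟨i, by omega⟩, fun z => ?_⟩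
    have e : (fun j : Fin b => Function.update a i z (s + j)) = fun j : Fin b => a (s + j) := by
      funext j; rw [Function.update_of_ne (by omega)]
    rw [insertComp, e, MultilinearMap.toLinearMap_apply]
    congr 1
    funext j
    rcases eq_or_ne j ⟨i, by omega⟩ with rfl | h
    · simp [insertAt, h1]
    · have : (j : ℕ) ≠ i := fun hi => h (Fin.ext hi)
      rw [Function.update_of_ne h, insertAt, insertAt, Function.update_of_ne this]
      split_ifs
      · rfl
      · rfl
      · rw [Function.update_of_ne (by omega)]
  rcases lt_or_ge i (s + b) with h2 | h2
  · refine ⟨(P (s + 1 + t)).toLinearMap (fun j => insertAt a s b 0 j) ⟨s, by omega⟩ ∘ₗ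
      (R b).toLinearMap (fun j => a (s + j)) ⟨i - s, by omega⟩, fun z => ?_⟩
    have e : (fun j : Fin b => Function.update a i z (s + j)) =
        Function.update (fun j : Fin b => a (s + j)) ⟨i - s, by omega⟩ z := by
      funext j
      rcases eq_or_ne j ⟨i - s, by omega⟩ with rfl | h
      · have : s + (i - s) = i := by omega
        simp [this]
      · have : (j : ℕ) ≠ i - s := fun hi => h (Fin.ext hi)
        rw [Function.update_of_ne h, Function.update_of_ne (by omega)]
    rw [insertComp, e, LinearMap.comp_apply, MultilinearMap.toLinearMap_apply,
      MultilinearMap.toLinearMap_apply, ← insertAt_eq_update]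
    congr 1
    funext j
    unfold insertAt
    split_ifs
    · rw [Function.update_of_ne (by omega)]
    · rfl
    · rw [Function.update_of_ne (by omega)]
  · refine ⟨(P (s + 1 + t)).toLinearMap (fun j => insertAt a s b (R b fun j => a (s + j)) j)
      ⟨i + 1 - b, by omega⟩, fun z => ?_⟩
    have e : (fun j : Fin b => Function.update a i z (s + j)) = fun j : Fin b => a (s + j) := by
      funext j; rw [Function.update_of_ne (by omega)]
    rw [insertComp, e, MultilinearMap.toLinearMap_apply]
    congr 1
    funext j
    rcases eq_or_ne j ⟨i + 1 - b, by omega⟩ with rfl | h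
    · have h3 : ¬ i + 1 - b < s := by omega
      have h4 : ¬ i + 1 - b = s := by omega
      have h5 : i + 1 - b - 1 + b = i := by omega
      simp [insertAt, h3, h4, h5]
    · have : (j : ℕ) ≠ i + 1 - b := fun hi => h (Fin.ext hi)
      rw [Function.update_of_ne h, insertAt, insertAt]
      split_ifs
      · rw [Function.update_of_ne (by omega)]
      · rfl
      · rw [Function.update_of_ne (by omega)]

/-- `insertComp` as a multilinear map in `k = s + b + t` variables. -/
def insertCompMultilinear (P R : (k : ℕ) → MultilinearMap K (fun _ : Fin k => A) A)
    (s b t k : ℕ) : MultilinearMap K (fun _ : Fin k => A) A :=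
  if h : k = s + b + t then
    MultilinearMap.mk' (fun v => insertComp P R s b t (extendZero v))
      (by
        intro v i y z
        obtain ⟨f, hf⟩ := exists_insertComp_update P R s b t (extendZero v) i (by omega)
        simp only [extendZero_update, hf, map_add])
      (by
        intro v i c z
        obtain ⟨f, hf⟩ := exists_insertComp_update P R s b t (extendZero v) i (by omega)
        simp only [extendZero_update, hf, map_smul])
  else 0

theorem insertComp_congr (P R : (k : ℕ) → MultilinearMap K (fun _ : Fin k => A) A) (s b t : ℕ)
    {a a' : ℕ → A} (h : ∀ i < s + b + t, a i = a' i) :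
    insertComp P R s b t a = insertComp P R s b t a' := by
  unfold insertComp
  have e : (fun j : Fin b => a (s + j)) = fun j : Fin b => a' (s + j) := by
    funext j; exact h _ (by omega)
  rw [e]
  congr 1
  funext i
  unfold insertAt
  split_ifs
  · exact h _ (by omega)
  · rfl
  · exact h _ (by omega)

theorem insertCompMultilinear_apply (P R : (k : ℕ) → MultilinearMap K (fun _ : Fin k => A) A)
    (s b t : ℕ) (a : ℕ → A) (v : Fin (s + b + t) → A) (h : ∀ i, v i = a i) :
    insertCompMultilinear P R s b t (s + b + t) v = insertComp P R s b t a := by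
  rw [insertCompMultilinear, dif_pos rfl]
  exact insertComp_congr P R s b t fun i hi => (extendZero_val v ⟨i, hi⟩).trans (h ⟨i, hi⟩)

namespace ShiftedAInfAlgebra

variable (𝔸 : ShiftedAInfAlgebra K A)

/-- The exponent `∑_{i < j < k} p_j q_i` of a Koszul sign. -/
def koszul (p q : ℕ → ℤ) (k : ℕ) : ℤ :=
  ∑ j ∈ Finset.range k, ∑ i ∈ Finset.range j, p j * q i

/-- Collapsing a block keeps the exponent except for the `+ 1` in `p' s`, the degree of the inner
operation. That degree one passes the first `s` cochains, which costs `∑_{i<s} q i`. -/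
theorem koszul_insert (p q p' q' : ℕ → ℤ) (s b t : ℕ)
    (hp : ∀ i < s, p' i = p i) (hq : ∀ i < s, q' i = q i)
    (hps : p' s = ∑ j ∈ Finset.range b, p (s + j) + 1)
    (hqs : q' s = ∑ j ∈ Finset.range b, q (s + j))
    (hpt : ∀ i < t, p' (s + 1 + i) = p (s + b + i))
    (hqt : ∀ i < t, q' (s + 1 + i) = q (s + b + i)) :
    koszul p' q' (s + 1 + t) + koszul (fun j => p (s + j)) (fun j => q (s + j)) b =
      koszul p q (s + b + t) + ∑ i ∈ Finset.range s, q i := by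
  have hs : ∀ (k : ℕ), k ≤ s → ∑ i ∈ Finset.range k, q' i = ∑ i ∈ Finset.range k, q i :=
    fun k hk => Finset.sum_congr rfl fun i hi => hq i (by have := Finset.mem_range.1 hi; omega)
  simp only [koszul, ← Finset.mul_sum]
  rw [Finset.sum_range_add, Finset.sum_range_add _ (s + b), Finset.sum_range_succ,
    Finset.sum_range_add _ s b]
  have e1 : ∑ j ∈ Finset.range s, p' j * ∑ i ∈ Finset.range j, q' i =
      ∑ j ∈ Finset.range s, p j * ∑ i ∈ Finset.range j, q i := by
    refine Finset.sum_congr rfl fun j hj => ?_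
    have := Finset.mem_range.1 hj
    rw [hp j this, hs j this.le]
  have e2 : ∑ j ∈ Finset.range t, p' (s + 1 + j) * ∑ i ∈ Finset.range (s + 1 + j), q' i =
      ∑ j ∈ Finset.range t, p (s + b + j) * ∑ i ∈ Finset.range (s + b + j), q i := by
    refine Finset.sum_congr rfl fun j hj => ?_
    have hj := Finset.mem_range.1 hj
    rw [hpt j hj, Finset.sum_range_add, Finset.sum_range_succ, hs s le_rfl, hqs,
      Finset.sum_range_add _ (s + b), Finset.sum_range_add _ s b]
    congr 2
    refine Finset.sum_congr rfl fun i hi => hqt i ?_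
    have := Finset.mem_range.1 hi; omega
  have e3 : ∑ j ∈ Finset.range b, p (s + j) * ∑ i ∈ Finset.range (s + j), q i =
      (∑ j ∈ Finset.range b, p (s + j)) * ∑ i ∈ Finset.range s, q i +
        ∑ j ∈ Finset.range b, p (s + j) * ∑ i ∈ Finset.range j, q (s + i) := by
    rw [Finset.sum_mul, ← Finset.sum_add_distrib]
    exact Finset.sum_congr rfl fun j _ => by rw [Finset.sum_range_add, mul_add]
  rw [e1, e2, e3, hps, hs s le_rfl]
  ring

theorem QTensorCup_tmul_seq (k : ℕ) (p : ℕ → ℤ) (q : ℕ → ℕ) (a : ℕ → A) (c : ℕ → NCochain K n)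
    (ha : ∀ j < k, a j ∈ 𝔸.gr (p j)) (hc : ∀ j < k, c j ∈ NCochain.gr (q j)) :
    𝔸.QTensorCup n k (fun j => a j ⊗ₜ[K] c j) =
      (koszul p (fun i => q i) k).negOnePow •
        (𝔸.Q k (fun j => a j) ⊗ₜ[K] ((List.range k).map c).prod) := by
  rw [𝔸.QTensorCup_tmul n k (fun j => p j) (fun j => q j) (fun j => a j) (fun j => c j)
    (fun j => ha j j.2) (fun j => hc j j.2)]
  congr 2
  · rw [koszul, Finset.sum_range]
    refine Finset.sum_congr rfl fun j _ => ?_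
    refine Finset.sum_bij (fun i _ => (i : ℕ)) ?_ ?_ ?_ ?_
    · intro i hi; simpa using hi
    · intro i _ j _ h; exact Fin.ext h
    · intro i hi
      have := Finset.mem_range.1 hi
      exact ⟨⟨i, by omega⟩, by simpa [Fin.lt_def] using hi, rfl⟩
    · intro i _; rfl
  · congr 2
    rw [List.ofFn_eq_map, ← List.map_coe_finRange_eq_range, List.map_map]
    rfl

/-- By associativity the cochain factor is the full product whatever block is collapsed, so only the
sign depends on `s`, and `koszul_insert` computes it. -/
theorem insertComp_QTensorCup_tmul (s b t : ℕ) (p : ℕ → ℤ) (q : ℕ → ℕ) (a : ℕ → A)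
    (c : ℕ → NCochain K n) (ha : ∀ j < s + b + t, a j ∈ 𝔸.gr (p j))
    (hc : ∀ j < s + b + t, c j ∈ NCochain.gr (q j)) :
    insertComp (𝔸.QTensorCup n) (𝔸.QTensorCup n) s b t (fun j => a j ⊗ₜ[K] c j) =
      (koszul p (fun i => q i) (s + b + t) + ∑ i ∈ Finset.range s, (q i : ℤ)).negOnePow •
        (insertComp 𝔸.Q 𝔸.Q s b t a ⊗ₜ[K] ((List.range (s + b + t)).map c).prod) := by
  set z : A := 𝔸.Q b fun j => a (s + j) with hz
  set w : NCochain K n := ((List.range b).map fun j => c (s + j)).prod with hw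
  set c' : ℕ → NCochain K n := insertAt c s b w with hc'
  -- `p'` and `q'` are the degrees after the block has been replaced by `z` and `w`.
  set p' : ℕ → ℤ := insertAt p s b (∑ j ∈ Finset.range b, p (s + j) + 1) with hp'
  set q' : ℕ → ℕ := fun i =>
    if i < s then q i else if i = s then ∑ j ∈ Finset.range b, q (s + j) else q (i - 1 + b) with hq'
  have hzg : z ∈ 𝔸.gr (∑ j ∈ Finset.range b, p (s + j) + 1) := by
    rw [Finset.sum_range]
    exact 𝔸.Q_mem_gr b (fun j => p (s + j)) _ fun j => ha _ (by omega)
  have hwg : w ∈ NCochain.gr (K := K) (∑ j ∈ Finset.range b, q (s + j)) :=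
    NCochain.prod_map_range_mem_gr _ _ b fun i hi => hc _ (by omega)
  have hin := 𝔸.QTensorCup_tmul_seq b (fun j => p (s + j)) (fun j => q (s + j))
    (fun j => a (s + j)) (fun j => c (s + j)) (fun j hj => ha _ (by omega))
    fun j hj => hc _ (by omega)
  have hout := 𝔸.QTensorCup_tmul_seq (s + 1 + t) p' q' (insertAt a s b z) c' (by
      intro j hj
      simp only [hp', insertAt]
      split_ifs
      · exact ha _ (by omega)
      · exact hzg
      · exact ha _ (by omega)) (by
      intro j hj
      simp only [hq', hc', insertAt]
      split_ifs
      · exact hc _ (by omega)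
      · exact hwg
      · exact hc _ (by omega))
  have hprod : ((List.range (s + 1 + t)).map c').prod = ((List.range (s + b + t)).map c).prod := by
    simp only [List.range_add, List.map_append, List.prod_append, List.map_map]
    have h1 : (List.range s).map c' = (List.range s).map c :=
      List.map_congr_left fun i hi => by simp [hc', insertAt, List.mem_range.1 hi]
    have h2 : (List.range t).map (c' ∘ fun x => s + 1 + x) =
        (List.range t).map (c ∘ fun x => s + b + x) :=
      List.map_congr_left fun i _ => by
        have e1 : ¬ s + 1 + i < s := by omega
        have e2 : ¬ s + 1 + i = s := by omega
        have e3 : s + i + b = s + b + i := by omega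
        simp [hc', insertAt, e1, e2, e3]
    rw [h1, h2]
    congr 2
    simp [hc', insertAt, hw, Function.comp_def]
  have hin' : (fun i : Fin (s + 1 + t) => insertAt (fun j => a j ⊗ₜ[K] c j) s b
      (z ⊗ₜ[K] w) i) = fun i : Fin (s + 1 + t) => insertAt a s b z i ⊗ₜ[K] c' i := by
    funext i
    simp only [hc', insertAt]
    split_ifs <;> rfl
  have hsgn := koszul_insert p (fun i => q i) p' (fun i => q' i) s b t
    (fun i hi => by simp [hp', insertAt, hi]) (fun i hi => by simp [hq', hi])
    (by simp [hp', insertAt]) (by simp [hq'])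
    (fun i _ => by
      have e1 : ¬ s + 1 + i < s := by omega
      have e2 : ¬ s + 1 + i = s := by omega
      have e3 : s + i + b = s + b + i := by omega
      simp [hp', insertAt, e1, e2, e3])
    (fun i _ => by
      have e1 : ¬ s + 1 + i < s := by omega
      have e2 : ¬ s + 1 + i = s := by omega
      have e3 : s + i + b = s + b + i := by omega
      simp [hq', e1, e2, e3])
  rw [insertComp, hin, insertAt_eq_update _ _ _ _ _ 0, Units.smul_def, ← Int.cast_smul_eq_zsmul K,
    MultilinearMap.map_update_smul, ← insertAt_eq_update, hin', hout, hprod, ← hsgn,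
    Int.cast_smul_eq_zsmul, ← Units.smul_def, smul_smul, ← Int.negOnePow_add, add_comm]
  rfl

/-- In total degree `0` the coefficient degrees are `-q j`, so the leftover sign of
`insertComp_QTensorCup_tmul` is the Koszul sign of `assoc`. The sum is, up to a common sign, the
relation in `A` tensored with one fixed product. -/
theorem sum_insertComp_QTensorCup_tmul (k : ℕ) (q : ℕ → ℕ) (a : ℕ → A)
    (c : ℕ → NCochain K n) (ha : ∀ j < k, a j ∈ 𝔸.gr (-(q j : ℤ)))
    (hc : ∀ j < k, c j ∈ NCochain.gr (q j)) :
    ∑ p ∈ Finset.HasAntidiagonal.antidiagonal k, ∑ r ∈ Finset.HasAntidiagonal.antidiagonal p.2,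
      insertComp (𝔸.QTensorCup n) (𝔸.QTensorCup n) p.1 r.1 r.2 (fun j => a j ⊗ₜ[K] c j) = 0 := by
  have h := 𝔸.assoc k (fun j => -(q j : ℤ)) a ha
  have h2 := congrArg (fun z => (koszul (fun j => -(q j : ℤ)) (fun i => q i) k).negOnePow •
    (z ⊗ₜ[K] ((List.range k).map c).prod)) h
  simp only [TensorProduct.zero_tmul, smul_zero, TensorProduct.sum_tmul, Finset.smul_sum] at h2
  rw [← h2]
  refine Finset.sum_congr rfl fun p hp => Finset.sum_congr rfl fun r hr => ?_
  have hk : k = p.1 + r.1 + r.2 := by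
    rw [Finset.HasAntidiagonal.mem_antidiagonal] at hp hr; omega
  subst hk
  rw [𝔸.insertComp_QTensorCup_tmul p.1 r.1 r.2 _ q a c ha hc, Int.negOnePow_add, ← smul_smul]
  congr 1
  rw [Finset.sum_neg_distrib, Int.negOnePow_neg, Units.smul_def, Units.smul_def,
    ← Int.cast_smul_eq_zsmul K, ← Int.cast_smul_eq_zsmul K, TensorProduct.smul_tmul']
  rfl

/-- The part of the `A_∞`-relations of `A ⊗ N^•(Δ^n)` that does not involve `d`, at an element of
degree `0`. -/
theorem sum_insertComp_QTensorCup {x : A ⊗[K] NCochain K n} (hx : x ∈ 𝔸.grExt n 0) (k : ℕ) :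
    ∑ p ∈ Finset.HasAntidiagonal.antidiagonal k, ∑ r ∈ Finset.HasAntidiagonal.antidiagonal p.2,
      insertComp (𝔸.QTensorCup n) (𝔸.QTensorCup n) p.1 r.1 r.2 (fun _ => x) = 0 := by
  -- The relation is the value of a multilinear map at a constant family. Expanding `x` in the basis
  -- of dual cochains reduces it to homogeneous pure tensors.
  set W : MultilinearMap K (fun _ : Fin k => A ⊗[K] NCochain K n) (A ⊗[K] NCochain K n) :=
    ∑ p ∈ Finset.HasAntidiagonal.antidiagonal k, ∑ r ∈ Finset.HasAntidiagonal.antidiagonal p.2,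
      insertCompMultilinear (𝔸.QTensorCup n) (𝔸.QTensorCup n) p.1 r.1 r.2 k with hW
  have hWapp : ∀ (a : ℕ → A ⊗[K] NCochain K n) (v : Fin k → A ⊗[K] NCochain K n),
      (∀ i, v i = a i) → W v = ∑ p ∈ Finset.HasAntidiagonal.antidiagonal k,
        ∑ r ∈ Finset.HasAntidiagonal.antidiagonal p.2,
          insertComp (𝔸.QTensorCup n) (𝔸.QTensorCup n) p.1 r.1 r.2 a := by
    intro a v h
    simp only [hW, sum_apply]
    refine Finset.sum_congr rfl fun p hp => Finset.sum_congr rfl fun r hr => ?_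
    have hk : k = p.1 + r.1 + r.2 := by
      rw [Finset.HasAntidiagonal.mem_antidiagonal] at hp hr; omega
    subst hk
    exact insertCompMultilinear_apply _ _ _ _ _ a v h
  rw [← hWapp (fun _ => x) (fun _ => x) fun _ => rfl, ← ofCoord_coord x, ofCoord,
    MultilinearMap.map_sum]
  refine Finset.sum_eq_zero fun I _ => ?_
  set q : ℕ → ℕ := fun i => if h : i < k then (I ⟨i, h⟩).dim else 0 with hq
  rw [hWapp (fun i => extendZero (fun j => coord K A (I j).1 x) i ⊗ₜ
      extendZero (fun j => (NCochain.φ (I j) : NCochain K n)) i) _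
    fun i => by rw [extendZero_val, extendZero_val]]
  refine 𝔸.sum_insertComp_QTensorCup_tmul k q _ _ (fun j hj => ?_) fun j hj => ?_
  · have h1 := (𝔸.mem_grExt_iff 0 x).1 hx (I ⟨j, hj⟩).1 (I ⟨j, hj⟩).2
    have h2 := Finset.card_pos.2 (I ⟨j, hj⟩).2
    have e : (0 : ℤ) + 1 - ((I ⟨j, hj⟩).1.card : ℤ) = -(q j : ℤ) := by
      simp only [hq, hj, dif_pos, NCochain.Simplex.dim]; omega
    rw [e] at h1
    simpa [extendZero, hj] using h1
  · simpa [extendZero, hj, hq] using NCochain.φ_mem_gr (I ⟨j, hj⟩)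

end ShiftedAInfAlgebra
end

/-! ### The derivation property of `id ⊗ d` and the Bianchi identity. -/

section

/-- The truncation contains every triple of weight `s + b + t < m`, and these cancel by `h0`. All
other terms already lie in `F m`. -/
theorem sum_triples_mem {M : Type*} [AddCommGroup M] {F : ℕ → AddSubgroup M} (hF : Antitone F)
    (f : ℕ → ℕ → ℕ → M) (hf : ∀ s b t, f s b t ∈ F (s + b + t))
    (h0 : ∀ k, ∑ p ∈ Finset.HasAntidiagonal.antidiagonal k,
      ∑ r ∈ Finset.HasAntidiagonal.antidiagonal p.2, f p.1 r.1 r.2 = 0)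
    {m N B : ℕ} (hN : m ≤ N) (hB : m ≤ B) :
    ∑ k ∈ Finset.range N, ∑ b ∈ Finset.range B, ∑ r ∈ Finset.HasAntidiagonal.antidiagonal k,
      f r.1 b r.2 ∈ F m := by
  -- The condition on `s + t` is the real truncation; the separate bounds on `s` and `t` only make
  -- the set finite.
  set T : Finset (ℕ × ℕ × ℕ) :=
    (Finset.range N ×ˢ Finset.range B ×ˢ Finset.range N).filter fun x => x.1 + x.2.2 < N with hT
  have hT1 : ∑ k ∈ Finset.range N, ∑ b ∈ Finset.range B,
      ∑ r ∈ Finset.HasAntidiagonal.antidiagonal k, f r.1 b r.2 =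
        ∑ x ∈ T, f x.1 x.2.1 x.2.2 := by
    simp only [Finset.sum_sigma']
    refine Finset.sum_bij' (fun x _ => (x.2.2.1, x.2.1, x.2.2.2))
      (fun x _ => ⟨x.1 + x.2.2, x.2.1, x.1, x.2.2⟩) ?_ ?_ ?_ ?_ ?_
    · rintro ⟨k, b, s, t⟩ h
      simp only [Finset.mem_sigma, Finset.mem_range, Finset.HasAntidiagonal.mem_antidiagonal] at h
      simp only [hT, Finset.mem_filter, Finset.mem_product, Finset.mem_range]
      omega
    · rintro ⟨s, b, t⟩ h
      simp only [hT, Finset.mem_filter, Finset.mem_product, Finset.mem_range] at h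
      simp only [Finset.mem_sigma, Finset.mem_range, Finset.HasAntidiagonal.mem_antidiagonal]
      exact ⟨by omega, by omega, trivial⟩
    · rintro ⟨k, b, s, t⟩ h
      simp only [Finset.mem_sigma, Finset.mem_range, Finset.HasAntidiagonal.mem_antidiagonal] at h
      obtain ⟨-, -, rfl⟩ := h
      rfl
    · rintro ⟨s, b, t⟩ h; rfl
    · rintro ⟨k, b, s, t⟩ h; rfl
  have hT0 : ∑ x ∈ T.filter (fun x => x.1 + x.2.1 + x.2.2 < m), f x.1 x.2.1 x.2.2 = 0 := by
    have : ∑ k ∈ Finset.range m, ∑ p ∈ Finset.HasAntidiagonal.antidiagonal k,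
        ∑ r ∈ Finset.HasAntidiagonal.antidiagonal p.2, f p.1 r.1 r.2 = 0 :=
      Finset.sum_eq_zero fun k _ => h0 k
    rw [← this]
    simp only [Finset.sum_sigma']
    symm
    refine Finset.sum_bij' (fun x _ => (x.2.1.1, x.2.2.1, x.2.2.2))
      (fun x _ => ⟨x.1 + x.2.1 + x.2.2, (x.1, x.2.1 + x.2.2), x.2.1, x.2.2⟩) ?_ ?_ ?_ ?_ ?_
    · rintro ⟨k, ⟨s, l⟩, b, t⟩ h
      simp only [Finset.mem_sigma, Finset.mem_range, Finset.HasAntidiagonal.mem_antidiagonal] at h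
      simp only [hT, Finset.mem_filter, Finset.mem_product, Finset.mem_range]
      omega
    · rintro ⟨s, b, t⟩ h
      simp only [hT, Finset.mem_filter, Finset.mem_product, Finset.mem_range] at h
      simp only [Finset.mem_sigma, Finset.mem_range, Finset.HasAntidiagonal.mem_antidiagonal]
      exact ⟨by omega, by omega, trivial⟩
    · rintro ⟨k, ⟨s, l⟩, b, t⟩ h
      simp only [Finset.mem_sigma, Finset.mem_range, Finset.HasAntidiagonal.mem_antidiagonal] at h
      obtain ⟨-, rfl, rfl⟩ := h
      simp only [add_assoc]
    · rintro ⟨s, b, t⟩ h; rfl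
    · rintro ⟨k, ⟨s, l⟩, b, t⟩ h; rfl
  rw [hT1, ← Finset.sum_filter_add_sum_filter_not T fun x => x.1 + x.2.1 + x.2.2 < m, hT0, zero_add]
  refine sum_mem fun x hx => hF ?_ (hf x.1 x.2.1 x.2.2)
  exact not_lt.1 (Finset.mem_filter.1 hx).2

theorem neg_one_pow_smul_eq {K M : Type*} [Field K] [AddCommGroup M] [Module K M] (m : ℕ) (v : M) :
    (-1 : K) ^ m • v = (m : ℤ).negOnePow • v := by
  rw [Int.negOnePow_def, zpow_natCast, Units.smul_def, ← Int.cast_smul_eq_zsmul K]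
  simp

variable {K : Type v} [Field K] {A : Type u} [AddCommGroup A] [Module K A] {n : ℕ}

namespace ShiftedAInfAlgebra

variable (𝔸 : ShiftedAInfAlgebra K A)

/-- Raising the degree of the `l`-th cochain by one adds `p j` for every later `j > l`. -/
theorem koszul_update (p q : ℕ → ℤ) (k l : ℕ) (hl : l < k) :
    koszul p (Function.update q l (q l + 1)) k + p l + ∑ i ∈ Finset.range l, p i =
      koszul p q k + ∑ i ∈ Finset.range k, p i := by
  obtain ⟨t, rfl⟩ := Nat.exists_eq_add_of_lt hl
  induction t with
  | zero =>
    simp only [koszul, add_zero, Finset.sum_range_succ]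
    have : ∀ j ≤ l, ∑ i ∈ Finset.range j, p j * Function.update q l (q l + 1) i =
        ∑ i ∈ Finset.range j, p j * q i := by
      intro j hj
      refine Finset.sum_congr rfl fun i hi => ?_
      rw [Function.update_of_ne]
      have := Finset.mem_range.1 hi; omega
    rw [this l le_rfl, Finset.sum_congr rfl fun j hj => this j (Finset.mem_range.1 hj).le]
    ring
  | succ t ih =>
    have ih := ih (by omega)
    have h1 : ∀ r : ℕ → ℤ, koszul p r (l + (t + 1) + 1) = koszul p r (l + t + 1) +
        p (l + t + 1) * ∑ i ∈ Finset.range (l + t + 1), r i := by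
      intro r
      rw [koszul, show l + (t + 1) + 1 = (l + t + 1) + 1 by ring, Finset.sum_range_succ,
        Finset.mul_sum]
      rfl
    have h2 : ∑ i ∈ Finset.range (l + t + 1), Function.update q l (q l + 1) i =
        ∑ i ∈ Finset.range (l + t + 1), q i + 1 := by
      have hl' : l ∈ Finset.range (l + t + 1) := Finset.mem_range.2 (by omega)
      rw [Finset.sum_update_of_mem hl', Finset.sum_eq_add_sum_sdiff_singleton_of_mem hl' q]
      ring
    rw [h1, h1, h2, show l + (t + 1) + 1 = (l + t + 1) + 1 by ring, Finset.sum_range_succ _ (l + t + 1)]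
    linear_combination ih

theorem dExt_dExt (v : A ⊗[K] NCochain K n) : 𝔸.dExt n (𝔸.dExt n v) = 0 := by
  induction v with
  | zero => simp
  | add x y hx hy => rw [map_add, map_add, hx, hy, add_zero]
  | tmul a c => rw [TensorProduct.map_tmul, TensorProduct.map_tmul, NCochain.d_d,
      TensorProduct.tmul_zero]

/-- After the Leibniz rule the terms cancel separately for each `l`. The two exponents differ by
exactly one, the degree of `Q k`, which `d` passes in the first expression but not in the second. -/
theorem dExt_QTensorCup_tmul (k : ℕ) (q : ℕ → ℕ) (a : ℕ → A)
    (c : ℕ → NCochain K n) (ha : ∀ j < k, a j ∈ 𝔸.gr (-(q j : ℤ)))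
    (hc : ∀ j < k, c j ∈ NCochain.gr (q j)) :
    𝔸.dExt n (𝔸.QTensorCup n k fun j => a j ⊗ₜ[K] c j) +
      ∑ l : Fin k, 𝔸.QTensorCup n k
        (Function.update (fun j => a j ⊗ₜ[K] c j) l (𝔸.dExt n (a l ⊗ₜ[K] c l))) = 0 := by
  set p : ℕ → ℤ := fun j => -(q j : ℤ) with hp
  have hQ : 𝔸.Q k (fun j => a j) ∈ 𝔸.gr (∑ j ∈ Finset.range k, p j + 1) := by
    rw [Finset.sum_range]
    exact 𝔸.Q_mem_gr k (fun j => p j) _ fun j => ha _ j.2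
  rw [𝔸.QTensorCup_tmul_seq k p q a c ha hc, Units.smul_def, map_zsmul, ← Units.smul_def,
    TensorProduct.map_tmul, 𝔸.parity_of_mem hQ, NCochain.d_prod_map_range c q k hc,
    TensorProduct.tmul_sum, Finset.smul_sum, Finset.sum_range, ← Finset.sum_add_distrib]
  refine Finset.sum_eq_zero fun l _ => ?_
  -- Rewritten as a scalar multiple of a family of pure tensors, so that the sign from passing `a l`
  -- can be pulled out.
  have hu : Function.update (fun j : Fin k => a j ⊗ₜ[K] c j) l (𝔸.dExt n (a l ⊗ₜ[K] c l)) =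
      Function.update (fun j : Fin k => a j ⊗ₜ[K] Function.update c l (NCochain.d (c l)) j) l
        ((p l).negOnePow • (a l ⊗ₜ[K] Function.update c l (NCochain.d (c l)) l)) := by
    funext i
    rcases eq_or_ne i l with rfl | h
    · rw [Function.update_self, Function.update_self, Function.update_self, TensorProduct.map_tmul,
        𝔸.parity_of_mem (ha i i.2), Units.smul_def, Units.smul_def, ← Int.cast_smul_eq_zsmul K,
        ← Int.cast_smul_eq_zsmul K, TensorProduct.smul_tmul']
    · have : (i : ℕ) ≠ l := fun hi => h (Fin.ext hi)
      rw [Function.update_of_ne h, Function.update_of_ne h, Function.update_of_ne this]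
  have hseq := 𝔸.QTensorCup_tmul_seq k p (Function.update q l (q l + 1)) a
    (Function.update c l (NCochain.d (c l))) ha (by
      intro j hj
      rcases eq_or_ne j l with rfl | h
      · simpa using NCochain.d_mem_gr (hc _ l.2)
      · simpa [h] using hc j hj)
  have hcast : (fun i => ((Function.update q l (q l + 1) i : ℕ) : ℤ)) =
      Function.update (fun i => (q i : ℤ)) l ((q l : ℤ) + 1) := by
    funext i
    rcases eq_or_ne i l with rfl | h
    · simp
    · simp [h]
  rw [hu, Units.smul_def (p l).negOnePow, ← Int.cast_smul_eq_zsmul K, MultilinearMap.map_update_smul,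
    Function.update_eq_self l (fun j : Fin k => a j ⊗ₜ[K] Function.update c l (NCochain.d (c l)) j),
    hseq, hcast, Int.cast_smul_eq_zsmul, ← Units.smul_def, smul_smul, ← Int.negOnePow_add,
    neg_one_pow_smul_eq, Units.smul_def (_ : ℤ).negOnePow (𝔸.Q k _),
    Units.smul_def (Int.negOnePow (_ : ℕ)), ← Int.cast_smul_eq_zsmul K, ← Int.cast_smul_eq_zsmul K,
    ← TensorProduct.smul_tmul', TensorProduct.tmul_smul, Int.cast_smul_eq_zsmul,
    Int.cast_smul_eq_zsmul, ← Units.smul_def, ← Units.smul_def, smul_smul, smul_smul,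
    ← Int.negOnePow_add, ← Int.negOnePow_add]
  have hk := koszul_update p (fun i => (q i : ℤ)) k l l.2
  have hs : ∑ i ∈ Finset.range (l : ℕ), p i = -((∑ i ∈ Finset.range (l : ℕ), q i : ℕ) : ℤ) := by
    simp [hp]
  have he : p l + koszul p (Function.update (fun i => (q i : ℤ)) l ((q l : ℤ) + 1)) k =
      koszul p (fun i => (q i : ℤ)) k + ∑ i ∈ Finset.range k, p i +
        ((∑ i ∈ Finset.range (l : ℕ), q i : ℕ) : ℤ) := by
    rw [hs] at hk; linear_combination hk
  have he' : koszul p (fun i => (q i : ℤ)) k + (∑ i ∈ Finset.range k, p i + 1) +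
      ((∑ i ∈ Finset.range (l : ℕ), q i : ℕ) : ℤ) =
        p l + koszul p (Function.update (fun i => (q i : ℤ)) l ((q l : ℤ) + 1)) k + 1 := by
    rw [he]; ring
  rw [he', Int.negOnePow_succ, Units.smul_def, Units.val_neg, neg_smul, ← Units.smul_def,
    neg_add_cancel]

variable (n) in
/-- The derivative at `x` of `x ↦ Q_k(x, …, x)`. -/
noncomputable def cupDeriv (k : ℕ) (x : A ⊗[K] NCochain K n) :
    A ⊗[K] NCochain K n →ₗ[K] A ⊗[K] NCochain K n :=
  ∑ j : Fin k, (𝔸.QTensorCup n k).toLinearMap (fun _ => x) j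

theorem cupDeriv_apply (k : ℕ) (x y : A ⊗[K] NCochain K n) :
    𝔸.cupDeriv n k x y = ∑ j : Fin k, 𝔸.QTensorCup n k (Function.update (fun _ => x) j y) := by
  simp [cupDeriv]

/-- The operator `id ⊗ d` is a derivation of the operations `Q_k ⊗ ∪^{(k)}`. -/
theorem dExt_QTensorCup {x : A ⊗[K] NCochain K n} (hx : x ∈ 𝔸.grExt n 0) (k : ℕ) :
    𝔸.dExt n (𝔸.QTensorCup n k fun _ => x) = -𝔸.cupDeriv n k x (𝔸.dExt n x) := by
  rw [eq_neg_iff_add_eq_zero, cupDeriv_apply]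
  -- Again a multilinear map whose value at the constant family is the claim, to be checked on basis
  -- tensors.
  set W : MultilinearMap K (fun _ : Fin k => A ⊗[K] NCochain K n) (A ⊗[K] NCochain K n) :=
    (𝔸.dExt n).compMultilinearMap (𝔸.QTensorCup n k) + ∑ l : Fin k,
      (𝔸.QTensorCup n k).compLinearMap fun i => if i = l then 𝔸.dExt n else LinearMap.id with hW
  have hWapp : ∀ v : Fin k → A ⊗[K] NCochain K n, W v = 𝔸.dExt n (𝔸.QTensorCup n k v) +
      ∑ l : Fin k, 𝔸.QTensorCup n k (Function.update v l (𝔸.dExt n (v l))) := by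
    intro v
    simp only [hW, add_apply, sum_apply, LinearMap.compMultilinearMap_apply,
      MultilinearMap.compLinearMap_apply]
    congr 1
    refine Finset.sum_congr rfl fun l _ => ?_
    congr 1
    funext i
    rcases eq_or_ne i l with rfl | h
    · simp
    · simp [h]
  rw [← hWapp fun _ => x, ← ofCoord_coord x, ofCoord, MultilinearMap.map_sum]
  refine Finset.sum_eq_zero fun I _ => ?_
  set q : ℕ → ℕ := fun i => if h : i < k then (I ⟨i, h⟩).dim else 0 with hq
  have := 𝔸.dExt_QTensorCup_tmul k q (extendZero fun j => coord K A (I j).1 x)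
    (extendZero fun j => (NCochain.φ (I j) : NCochain K n)) (fun j hj => ?_) fun j hj => ?_
  · rw [hWapp]
    simpa only [extendZero_val] using this
  · have h1 := (𝔸.mem_grExt_iff 0 x).1 hx (I ⟨j, hj⟩).1 (I ⟨j, hj⟩).2
    have h2 := Finset.card_pos.2 (I ⟨j, hj⟩).2
    have e : (0 : ℤ) + 1 - ((I ⟨j, hj⟩).1.card : ℤ) = -(q j : ℤ) := by
      simp only [hq, hj, dif_pos, NCochain.Simplex.dim]; omega
    rw [e] at h1
    simpa [extendZero, hj] using h1
  · simpa [extendZero, hj, hq] using NCochain.φ_mem_gr (I ⟨j, hj⟩)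

/-- This puts the derivative into the shape of the `A_∞`-relations. On a constant sequence the
length of the replaced block is irrelevant, hence the `0`. -/
theorem cupDeriv_succ (k : ℕ) (x z : A ⊗[K] NCochain K n) :
    𝔸.cupDeriv n (k + 1) x z = ∑ r ∈ Finset.HasAntidiagonal.antidiagonal k,
      𝔸.QTensorCup n (r.1 + 1 + r.2) (fun i => insertAt (fun _ => x) r.1 0 z i) := by
  rw [cupDeriv_apply, Finset.Nat.sum_antidiagonal_eq_sum_range_succ
    (fun s t => 𝔸.QTensorCup n (s + 1 + t) (fun i => insertAt (fun _ => x) s 0 z i)),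
    Finset.sum_range]
  refine Finset.sum_congr rfl fun j _ => ?_
  -- The arities `k + 1` and `s + 1 + t` are equal but not definitionally so; a free `l` permits
  -- substitution.
  have key : ∀ (l : ℕ) (hl : (j : ℕ) < l), l = k + 1 →
      𝔸.QTensorCup n (k + 1) (Function.update (fun _ => x) j z) =
        𝔸.QTensorCup n l (Function.update (fun _ => x) ⟨j, hl⟩ z) := by
    rintro l hl rfl; rfl
  rw [insertAt_const]
  exact key _ _ (by omega)

variable (n) in
/-- The partial sums of the curvature `∑_l Q_l(x, …, x)`. -/
noncomputable def curv (N : ℕ) (x : A ⊗[K] NCochain K n) : A ⊗[K] NCochain K n :=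
  ∑ l ∈ Finset.range N, 𝔸.QExt n l fun _ => x

theorem QExt_const (l : ℕ) (x : A ⊗[K] NCochain K n) :
    𝔸.QExt n l (fun _ => x) =
      𝔸.QTensorCup n l (fun _ => x) + if l = 1 then 𝔸.dExt n x else 0 := by
  match l with
  | 0 => simp [QExt]
  | 1 => simp [QExt]
  | l + 2 => simp [QExt]

theorem curv_eq {N : ℕ} (hN : 2 ≤ N) (x : A ⊗[K] NCochain K n) :
    𝔸.curv n N x = ∑ l ∈ Finset.range N, 𝔸.QTensorCup n l (fun _ => x) + 𝔸.dExt n x := by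
  simp only [curv, QExt_const, Finset.sum_add_distrib, Finset.sum_ite_eq', Finset.mem_range]
  rw [if_pos (by omega)]

end ShiftedAInfAlgebra

namespace FilteredShiftedAInfAlgebra

open ShiftedAInfAlgebra

variable (𝔸 : FilteredShiftedAInfAlgebra K A)

theorem cupDeriv_mem_FExt (l : ℕ) (x : A ⊗[K] NCochain K n) {k : ℕ}
    {y : A ⊗[K] NCochain K n} (hy : y ∈ 𝔸.FExt n k) :
    𝔸.cupDeriv n l x y ∈ 𝔸.FExt n (l - 1 + k) := by
  rw [cupDeriv_apply]
  exact Submodule.sum_mem _ fun j _ => 𝔸.QTensorCup_update_mem_FExt l _ j hy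

/-- The Bianchi identity for the partial sums of the curvature. -/
theorem dExt_curv_add_sum_cupDeriv_mem {x : A ⊗[K] NCochain K n} (hx : x ∈ 𝔸.grExt n 0)
    {m N : ℕ} (hm : m < N) (hN : 2 ≤ N) :
    𝔸.dExt n (𝔸.curv n N x) + ∑ k ∈ Finset.range N, 𝔸.cupDeriv n k x (𝔸.curv n N x) ∈
      𝔸.FExt n m := by
  rw [𝔸.curv_eq hN, map_add, 𝔸.dExt_dExt, add_zero, map_sum]
  simp only [map_add, Finset.sum_add_distrib, 𝔸.dExt_QTensorCup hx, Finset.sum_neg_distrib]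
  -- The derivatives at `d x` cancel, which leaves `∑_k` of the derivatives at `∑_b Q_b(x, …, x)`:
  -- the `A_∞`-relations, truncated.
  rw [neg_add_eq_sub, add_sub_cancel_right]
  obtain ⟨N', rfl⟩ : ∃ N', N = N' + 1 := ⟨N - 1, by omega⟩
  have h0 : ∀ y : A ⊗[K] NCochain K n, 𝔸.cupDeriv n 0 x y = 0 := fun y => by
    rw [cupDeriv_apply]; simp
  rw [Finset.sum_range_succ' _ N', h0, add_zero]
  simp only [map_sum, cupDeriv_succ]
  refine sum_triples_mem (F := fun k => (𝔸.FExt n k).toAddSubgroup)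
    (fun _ _ h => 𝔸.FExt_antitone h)
    (fun s b t => 𝔸.QTensorCup n (s + 1 + t)
      (fun i => insertAt (fun _ => x) s 0 (𝔸.QTensorCup n b fun _ => x) i)) ?_ ?_ ?_ ?_
  · intro s b t
    rw [insertAt_const]
    have := 𝔸.QTensorCup_update_mem_FExt (s + 1 + t) (fun _ => x) ⟨s, by omega⟩
      (𝔸.QTensorCup_mem_FExt_length b fun _ => x)
    have e : s + 1 + t - 1 + b = s + b + t := by omega
    rwa [e] at this
  · intro k
    rw [← 𝔸.sum_insertComp_QTensorCup hx k]
    refine Finset.sum_congr rfl fun p _ => Finset.sum_congr rfl fun r _ => ?_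
    rw [insertComp, insertAt_const, insertAt_const]
  · omega
  · omega

end FilteredShiftedAInfAlgebra

end

/-! ### Filling a horn: the fixed point and the vanishing of the curvature. -/

section

variable {K : Type v} [Field K] {A : Type u} [AddCommGroup A] [Module K A] {n : ℕ}

namespace ShiftedAInfAlgebra

variable (𝔸 : ShiftedAInfAlgebra K A)

theorem parity_mem_gr {p : ℤ} {a : A} (ha : a ∈ 𝔸.gr p) : 𝔸.parity a ∈ 𝔸.gr p := by
  rw [𝔸.parity_of_mem ha, Units.smul_def]
  exact zsmul_mem ha _

theorem dExt_mem_grExt {r : ℤ} {v : A ⊗[K] NCochain K n} (hv : v ∈ 𝔸.grExt n r) :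
    𝔸.dExt n v ∈ 𝔸.grExt n (r + 1) := by
  rw [mem_grExt_iff] at hv ⊢
  intro I _
  rw [coord_dExt]
  refine Submodule.sum_mem _ fun i hi => Submodule.smul_mem _ _ (𝔸.parity_mem_gr ?_)
  -- At a vertex the deleted face is empty, where every coordinate is `0`.
  rcases (I.erase i).eq_empty_or_nonempty with h | h
  · simp [h]
  · have := hv _ h
    have hc := Finset.card_pos.2 ⟨i, hi⟩
    rw [Finset.card_erase_of_mem hi] at this
    have e : r + 1 + 1 - (I.card : ℤ) = r + 1 - ((I.card - 1 : ℕ) : ℤ) := by omega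
    rwa [e]

theorem QTensorCup_mem_grExt (k : ℕ) {x : A ⊗[K] NCochain K n} (hx : x ∈ 𝔸.grExt n 0) :
    𝔸.QTensorCup n k (fun _ => x) ∈ 𝔸.grExt n 1 := by
  rw [QTensorCup_apply]
  refine Submodule.sum_mem _ fun I _ => ?_
  have hQ := 𝔸.Q_mem_gr k (fun j => -((I j).dim : ℤ))
    (fun j => (𝔸.parity ^ ∑ i ∈ Finset.Iio j, (I i).dim) (coord K A (I j).1 x)) (by
      intro j
      have h1 := (𝔸.mem_grExt_iff 0 x).1 hx (I j).1 (I j).2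
      have h2 := Finset.card_pos.2 (I j).2
      have e : (0 : ℤ) + 1 - ((I j).1.card : ℤ) = -((I j).dim : ℤ) := by
        simp only [NCochain.Simplex.dim]; omega
      rw [e] at h1
      generalize ∑ i ∈ Finset.Iio j, (I i).dim = e
      induction e with
      | zero => simpa
      | succ e ih => rw [pow_succ', Module.End.mul_apply]; exact 𝔸.parity_mem_gr ih)
  have hN : (List.ofFn fun j => (NCochain.φ (I j) : NCochain K n)).prod ∈
      NCochain.gr (K := K) (∑ j, (I j).dim) := by
    have := NCochain.prod_map_range_mem_gr
      (extendZero fun j => (NCochain.φ (I j) : NCochain K n))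
      (fun i => if h : i < k then (I ⟨i, h⟩).dim else 0) k (fun i hi => by
        simpa [extendZero, hi] using NCochain.φ_mem_gr (I ⟨i, hi⟩))
    rw [Finset.sum_range] at this
    have e : (List.range k).map (extendZero fun j => (NCochain.φ (I j) : NCochain K n)) =
        List.ofFn fun j => (NCochain.φ (I j) : NCochain K n) := by
      rw [List.ofFn_eq_map, ← List.map_coe_finRange_eq_range, List.map_map]
      exact List.map_congr_left fun j _ => extendZero_val _ j
    rw [e] at this
    simpa using this
  refine Submodule.mem_iSup_of_mem _ (Submodule.mem_iSup_of_mem _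
      (Submodule.mem_iSup_of_mem ?_ (Submodule.apply_mem_map₂ _ hQ hN)))
  push_cast
  rw [Finset.sum_neg_distrib]
  ring

theorem curv_mem_grExt (N : ℕ) {x : A ⊗[K] NCochain K n} (hx : x ∈ 𝔸.grExt n 0) :
    𝔸.curv n N x ∈ 𝔸.grExt n 1 := by
  refine Submodule.sum_mem _ fun l _ => ?_
  rw [QExt_const]
  refine Submodule.add_mem _ (𝔸.QTensorCup_mem_grExt l hx) ?_
  split_ifs
  · simpa using 𝔸.dExt_mem_grExt hx
  · exact Submodule.zero_mem _

end ShiftedAInfAlgebra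

namespace FilteredShiftedAInfAlgebra

open ShiftedAInfAlgebra

variable (𝔸 : FilteredShiftedAInfAlgebra K A)

theorem pullT_curv {m : ℕ} (θ : Fin (m + 1) →o Fin (n + 1)) (N : ℕ) (x : A ⊗[K] NCochain K n) :
    pullT A θ (𝔸.curv n N x) = 𝔸.curv m N (pullT A θ x) := by
  simp only [curv, map_sum, pullT_QExt]

/-- The difference telescopes by changing `y` to `x` one slot at a time; each summand has `x - y` in
one slot. -/
theorem QTensorCup_sub_mem_FExt (l : ℕ) {x y : A ⊗[K] NCochain K n} {k : ℕ}
    (h : x - y ∈ 𝔸.FExt n k) :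
    𝔸.QTensorCup n l (fun _ => x) - 𝔸.QTensorCup n l (fun _ => y) ∈ 𝔸.FExt n (l - 1 + k) := by
  set g : ℕ → A ⊗[K] NCochain K n := fun i =>
    𝔸.QTensorCup n l fun j => if (j : ℕ) < i then x else y with hg
  have hl : g l = 𝔸.QTensorCup n l fun _ => x := by simp [hg]
  have h0 : g 0 = 𝔸.QTensorCup n l fun _ => y := by simp [hg]
  rw [← hl, ← h0, ← Finset.sum_range_sub]
  refine Submodule.sum_mem _ fun i hi => ?_
  have hi := Finset.mem_range.1 hi
  have e1 : (fun j : Fin l => if (j : ℕ) < i + 1 then x else y) =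
      Function.update (fun j : Fin l => if (j : ℕ) < i then x else y) ⟨i, hi⟩ x := by
    funext j
    rcases eq_or_ne j ⟨i, hi⟩ with rfl | hj
    · simp
    · have : (j : ℕ) ≠ i := fun he => hj (Fin.ext he)
      rw [Function.update_of_ne hj]
      have : (j : ℕ) < i + 1 ↔ (j : ℕ) < i := by omega
      simp only [this]
  have e2 : (fun j : Fin l => if (j : ℕ) < i then x else y) =
      Function.update (fun j : Fin l => if (j : ℕ) < i then x else y) ⟨i, hi⟩ y := by
    rw [eq_comm, Function.update_eq_self_iff]; simp
  have e3 : g (i + 1) - g i = 𝔸.QTensorCup n l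
      (Function.update (fun j : Fin l => if (j : ℕ) < i then x else y) ⟨i, hi⟩ (x - y)) := by
    simp only [hg]
    rw [MultilinearMap.map_update_sub, ← e1, ← e2]
  rw [e3]
  exact 𝔸.QTensorCup_update_mem_FExt l _ _ h

theorem neg_one_pow_smul_mem_F_iff (e k : ℕ) (a : A) :
    (-1 : K) ^ e • a ∈ 𝔸.F k ↔ a ∈ 𝔸.F k :=
  Submodule.smul_mem_iff _ (pow_ne_zero _ (by simp))

/-- If all components of the curvature but the one at a facet of `Δ^{n+1}` vanish, then so does that
one, by the Bianchi identity. -/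
theorem isMaurerCartan_of_coord_curv (k : Fin (n + 2)) {x : A ⊗[K] NCochain K (n + 1)}
    (hx : x ∈ 𝔸.grExt (n + 1) 0)
    (h : ∀ m, ∃ N, ∀ N' ≥ N, ∀ I : Finset (Fin (n + 2)), I.Nonempty → I ≠ Finset.univ.erase k →
      coord K A I (𝔸.curv (n + 1) N' x) ∈ 𝔸.F m) :
    IsMaurerCartan (𝔸.grExt (n + 1)) (𝔸.FExt (n + 1)) (𝔸.QExt (n + 1)) x := by
  refine ⟨hx, fun m => ?_⟩
  obtain ⟨N, hN⟩ := h m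
  refine ⟨max N (m + 2), fun N' hN' => ?_⟩
  have hNN : N ≤ N' := (le_max_left _ _).trans hN'
  have hmN : m + 2 ≤ N' := (le_max_right _ _).trans hN'
  change 𝔸.curv (n + 1) N' x ∈ _
  have hr := hN N' hNN
  have hB := 𝔸.dExt_curv_add_sum_cupDeriv_mem hx (m := m) (N := N') (by omega) (by omega)
  set r := 𝔸.curv (n + 1) N' x with hrdef
  -- Bootstrapping: once all of `r` lies in step `j`, the Bianchi identity at the top simplex moves
  -- the missing component to step `j + 1`. The other components are in step `m` from the start.
  have main : ∀ j ≤ m, r ∈ 𝔸.FExt (n + 1) j := by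
    intro j
    induction j with
    | zero => exact fun _ => 𝔸.FExt_antitone (Nat.zero_le 1) (𝔸.mem_FExt_one r)
    | succ j ih =>
      intro hj
      have ih := ih (by omega)
      refine 𝔸.mem_FExt_iff.2 fun I hI => ?_
      by_cases hIk : I = Finset.univ.erase k
      swap
      · exact 𝔸.F_antitone hj (hr I hI hIk)
      subst hIk
      have htop : (Finset.univ : Finset (Fin (n + 2))) ≠ Finset.univ.erase k := by
        intro he
        have := Finset.mem_univ k
        rw [he] at this
        simp at this
      have h1 := 𝔸.F_antitone hj (𝔸.coord_mem_F hB Finset.univ)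
      rw [map_add, map_sum] at h1
      have h2 : ∑ l ∈ Finset.range N', coord K A Finset.univ (𝔸.cupDeriv (n + 1) l x r) ∈
          𝔸.F (j + 1) := by
        refine Submodule.sum_mem _ fun l _ => ?_
        match l with
        | 0 => rw [cupDeriv_apply]; simp
        | 1 =>
          -- `Q 1` gains nothing, but it sees only the top component of `r`, which is already in `F
          -- m`.
          rw [cupDeriv_apply, Fin.sum_univ_one, coord_QTensorCup_one _ _ Finset.univ_nonempty]
          have := 𝔸.Q_mem_F 1 (fun _ => m) (fun j => coord K A Finset.univ
            (Function.update (fun _ => x) 0 r j)) (by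
              intro i
              rw [Subsingleton.elim i 0, Function.update_self]
              exact hr _ Finset.univ_nonempty htop)
          exact 𝔸.F_antitone (by simpa using hj) this
        | l + 2 =>
          exact 𝔸.F_antitone (by omega)
            (𝔸.coord_mem_F (𝔸.cupDeriv_mem_FExt (l + 2) x ih) Finset.univ)
      have h3 := (Submodule.add_mem_iff_left _ h2).1 h1
      -- The top component of `d r` is a signed sum over facets, and only the facet opposite `k` is
      -- not yet controlled.
      rw [coord_dExt, ← Finset.add_sum_erase _ _ (Finset.mem_univ k)] at h3
      have h4 := (Submodule.add_mem_iff_left _ (Submodule.sum_mem _ fun i hi => by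
        rw [neg_one_pow_smul_mem_F_iff, parity_mem_F_iff]
        rcases (Finset.univ.erase i).eq_empty_or_nonempty with h | h
        · rw [h]; simp
        · refine 𝔸.F_antitone hj (hr _ h fun he => ?_)
          have hi := (Finset.mem_erase.1 hi).1
          have : i ∈ Finset.univ.erase k := by simp [hi]
          rw [← he] at this
          simp at this)).1 h3
      rwa [neg_one_pow_smul_mem_F_iff, parity_mem_F_iff] at h4
  exact main m le_rfl

/-- The facet of `Δ^{n+1}` opposite to the vertex `k`. -/
abbrev oppFacet (k : Fin (n + 2)) : NCochain.Simplex (n + 1) :=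
  ⟨Finset.univ.erase k, by
    obtain ⟨j, hj⟩ := exists_ne k
    exact ⟨j, by simp [hj]⟩⟩

/-- A facet meets the top simplex with incidence number `±1`. The linear part of the equation for
`b` is therefore a signed `parity`, which is its own inverse. -/
theorem coord_univ_dExt_tmul_φ (k : Fin (n + 2)) (b : A) :
    coord K A Finset.univ (𝔸.dExt (n + 1) (b ⊗ₜ NCochain.φ (oppFacet k))) =
      (-1 : K) ^ ((Finset.univ : Finset (Fin (n + 2))).filter (· < k)).card • 𝔸.parity b := by
  rw [coord_dExt, Finset.sum_eq_single k]
  · simp [coord_tmul, NCochain.φ_apply]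
  · intro i _ hi
    rw [coord_tmul, NCochain.φ_apply, if_neg, zero_smul, map_zero, smul_zero]
    intro he
    have : i ∈ (oppFacet k).1 := by simp [hi]
    rw [← he] at this
    simp at this
  · simp

/-- One step of the iteration that finds the missing facet of a horn. -/
noncomputable def hornStep (k : Fin (n + 2)) (x : A ⊗[K] NCochain K (n + 1)) (N : ℕ) (b : A) : A :=
  b - (-1 : K) ^ ((Finset.univ : Finset (Fin (n + 2))).filter (· < k)).card •
    𝔸.parity (coord K A Finset.univ (𝔸.curv (n + 1) N (x + b ⊗ₜ NCochain.φ (oppFacet k))))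

section HornStep

variable (k : Fin (n + 2)) {x : A ⊗[K] NCochain K (n + 1)}

theorem add_tmul_φ_mem_grExt (hx : x ∈ 𝔸.grExt (n + 1) 0) {b : A} (hb : b ∈ 𝔸.gr (-n)) :
    x + b ⊗ₜ NCochain.φ (oppFacet k) ∈ 𝔸.grExt (n + 1) 0 := by
  refine Submodule.add_mem _ hx ?_
  refine Submodule.mem_iSup_of_mem _ (Submodule.mem_iSup_of_mem _
      (Submodule.mem_iSup_of_mem ?_ (Submodule.apply_mem_map₂ _ hb (NCochain.φ_mem_gr _))))
  simp [NCochain.Simplex.dim]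

theorem hornStep_mem_gr (hx : x ∈ 𝔸.grExt (n + 1) 0) (N : ℕ) {b : A} (hb : b ∈ 𝔸.gr (-n)) :
    𝔸.hornStep k x N b ∈ 𝔸.gr (-n) := by
  refine Submodule.sub_mem _ hb (Submodule.smul_mem _ _ (𝔸.parity_mem_gr ?_))
  have := (𝔸.mem_grExt_iff 1 _).1 (𝔸.curv_mem_grExt N (𝔸.add_tmul_φ_mem_grExt k hx hb))
    Finset.univ Finset.univ_nonempty
  have e : (1 : ℤ) + 1 - ((Finset.univ : Finset (Fin (n + 2))).card : ℤ) = -n := by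
    rw [Finset.card_univ, Fintype.card_fin]; push_cast; ring
  rwa [e] at this

/-- The longer truncation adds only `Q_N ⊗ ∪`, of filtration `N`; for `N ≥ 2` the term with `d` is
already present. -/
theorem hornStep_succ_sub_mem {N : ℕ} (hN : 2 ≤ N) (b : A) :
    𝔸.hornStep k x (N + 1) b - 𝔸.hornStep k x N b ∈ 𝔸.F N := by
  have h : 𝔸.curv (n + 1) (N + 1) (x + b ⊗ₜ NCochain.φ (oppFacet k)) =
      𝔸.curv (n + 1) N (x + b ⊗ₜ NCochain.φ (oppFacet k)) +
        𝔸.QTensorCup (n + 1) N fun _ => x + b ⊗ₜ NCochain.φ (oppFacet k) := by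
    rw [curv, Finset.sum_range_succ, QExt_const, if_neg (by omega), add_zero]
    rfl
  rw [hornStep, hornStep, h, map_add, map_add, smul_add, sub_sub_sub_cancel_left,
    sub_add_cancel_left, Submodule.neg_mem_iff, neg_one_pow_smul_mem_F_iff, parity_mem_F_iff]
  exact 𝔸.coord_mem_F (𝔸.QTensorCup_mem_FExt_length N _) _

/-- The step is a contraction. Its correction cancels the linear term `b - b'` exactly and leaves
`δ`, where arity `0` is constant, arity `1` sees only the zero top coordinate, and higher arities
gain a filtration step. -/
theorem hornStep_sub_mem (hx0 : coord K A Finset.univ x = 0) {N : ℕ} (hN : 2 ≤ N) {m : ℕ} {b b' : A}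
    (hb : b - b' ∈ 𝔸.F m) :
    𝔸.hornStep k x N b - 𝔸.hornStep k x N b' ∈ 𝔸.F (m + 1) := by
  set X : A → A ⊗[K] NCochain K (n + 1) := fun b => x + b ⊗ₜ NCochain.φ (oppFacet k) with hX
  set ε : K := (-1) ^ ((Finset.univ : Finset (Fin (n + 2))).filter (· < k)).card with hε
  have hX0 : ∀ b, coord K A Finset.univ (X b) = 0 := by
    intro b
    rw [hX, map_add, hx0, coord_tmul, NCochain.φ_apply, if_neg, zero_smul, add_zero]
    intro he
    have := Finset.mem_univ k
    rw [he] at this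
    simp at this
  have hXF : X b - X b' ∈ 𝔸.FExt (n + 1) m := by
    rw [hX, add_sub_add_left_eq_sub, ← TensorProduct.sub_tmul]
    exact Submodule.apply_mem_map₂ _ hb Submodule.mem_top
  set δ : A := ∑ l ∈ Finset.range N, coord K A Finset.univ
    (𝔸.QTensorCup (n + 1) l (fun _ => X b) - 𝔸.QTensorCup (n + 1) l (fun _ => X b')) with hδ
  have hδF : δ ∈ 𝔸.F (m + 1) := by
    refine Submodule.sum_mem _ fun l _ => ?_
    match l with
    | 0 =>
      rw [Subsingleton.elim (fun _ : Fin 0 => X b) fun _ => X b', sub_self, map_zero]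
      exact Submodule.zero_mem _
    | 1 =>
      rw [map_sub, coord_QTensorCup_one _ _ Finset.univ_nonempty,
        coord_QTensorCup_one _ _ Finset.univ_nonempty, hX0, hX0, sub_self]
      exact Submodule.zero_mem _
    | l + 2 =>
      exact 𝔸.F_antitone (by omega)
        (𝔸.coord_mem_F (𝔸.QTensorCup_sub_mem_FExt (l + 2) hXF) _)
  have hcurv : coord K A Finset.univ (𝔸.curv (n + 1) N (X b)) -
      coord K A Finset.univ (𝔸.curv (n + 1) N (X b')) = δ + ε • 𝔸.parity (b - b') := by
    rw [← 𝔸.coord_univ_dExt_tmul_φ k, ← map_sub, 𝔸.curv_eq hN, 𝔸.curv_eq hN, add_sub_add_comm,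
      ← Finset.sum_sub_distrib, ← map_sub (𝔸.dExt (n + 1)), map_add, map_sum, hX,
      add_sub_add_left_eq_sub, TensorProduct.sub_tmul]
  have hεε : ε * ε = 1 := by
    rw [hε, ← mul_pow]; simp
  have : 𝔸.hornStep k x N b - 𝔸.hornStep k x N b' = -(ε • 𝔸.parity δ) := by
    rw [hornStep, hornStep, sub_sub_sub_comm, ← smul_sub, ← map_sub, hcurv, map_add, map_smul,
      parity_parity, smul_add, smul_smul, hεε, one_smul]
    abel
  rw [this, Submodule.neg_mem_iff, neg_one_pow_smul_mem_F_iff, parity_mem_F_iff]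
  exact hδF

/-- The missing facet of a horn can be chosen so that the curvature has no component at the top
simplex. -/
theorem exists_coord_univ_curv_mem (h𝔸 : 𝔸.IsComplete) (hx : x ∈ 𝔸.grExt (n + 1) 0)
    (hx0 : coord K A Finset.univ x = 0) :
    ∃ b ∈ 𝔸.gr (-n), ∀ m, ∃ N, ∀ N' ≥ N, coord K A Finset.univ
      (𝔸.curv (n + 1) N' (x + b ⊗ₜ NCochain.φ (oppFacet k))) ∈ 𝔸.F m := by
  -- The truncation grows along the iteration, so that the limit solves the equation for the whole
  -- series; it starts at `2` to include the term with `d`.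
  set β : ℕ → A := fun j => Nat.rec 0 (fun j b => 𝔸.hornStep k x (j + 2) b) j with hβ
  have hβs : ∀ j, β (j + 1) = 𝔸.hornStep k x (j + 2) (β j) := fun j => rfl
  have hgr : ∀ j, β j ∈ 𝔸.gr (-n) := by
    intro j
    induction j with
    | zero => exact Submodule.zero_mem _
    | succ j ih => exact 𝔸.hornStep_mem_gr k hx _ ih
  have hstep : ∀ j, β (j + 1) - β j ∈ 𝔸.F (j + 1) := by
    intro j
    induction j with
    | zero => rw [zero_add, 𝔸.F_one]; trivial
    | succ j ih =>
      -- First the truncation changes at a fixed argument, then the argument changes at a fixed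
      -- truncation.
      rw [hβs (j + 1), ← sub_add_sub_cancel _ (𝔸.hornStep k x (j + 2) (β (j + 1)))]
      refine Submodule.add_mem _ (𝔸.hornStep_succ_sub_mem k (by omega) _) ?_
      rw [hβs j]
      rw [hβs j] at ih
      exact 𝔸.hornStep_sub_mem k hx0 (by omega) ih
  have hcauchy : ∀ m i, β (m + i) - β m ∈ 𝔸.F m := by
    intro m i
    induction i with
    | zero => simp
    | succ i ih =>
      rw [← sub_add_sub_cancel _ (β (m + i))]
      exact Submodule.add_mem _ (𝔸.F_antitone (by omega) (hstep (m + i))) ih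
  obtain ⟨b, hb, hlim⟩ := h𝔸 (-n) β hgr fun m => ⟨m, fun i hi j hj => by
    obtain ⟨i, rfl⟩ := Nat.exists_eq_add_of_le hi
    obtain ⟨j, rfl⟩ := Nat.exists_eq_add_of_le hj
    rw [← sub_sub_sub_cancel_right _ _ (β m)]
    exact Submodule.sub_mem _ (hcauchy m i) (hcauchy m j)⟩
  refine ⟨b, hb, fun m => ?_⟩
  obtain ⟨N, hN⟩ := hlim m
  refine ⟨max N m + 2, fun N' hN' => ?_⟩
  obtain ⟨j, rfl⟩ : ∃ j, N' = j + 2 := ⟨N' - 2, by omega⟩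
  have hjN : N ≤ j := by omega
  have hjm : m ≤ j := by omega
  have h1 : 𝔸.hornStep k x (j + 2) (β j) - 𝔸.hornStep k x (j + 2) b ∈ 𝔸.F m :=
    𝔸.F_antitone (Nat.le_succ m) (𝔸.hornStep_sub_mem k hx0 (by omega) (hN j hjN))
  have h2 : β (j + 1) - β j ∈ 𝔸.F m := 𝔸.F_antitone (by omega) (hstep j)
  rw [hβs j] at h2
  -- The limit is fixed modulo `F m`, and its defect `b - hornStep b` is by definition the top
  -- curvature up to sign and `parity`.
  have h3 : b - 𝔸.hornStep k x (j + 2) b ∈ 𝔸.F m := by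
    have e : b - 𝔸.hornStep k x (j + 2) b =
        (𝔸.hornStep k x (j + 2) (β j) - 𝔸.hornStep k x (j + 2) b) -
          (𝔸.hornStep k x (j + 2) (β j) - β j) - (β j - b) := by abel
    rw [e]
    exact Submodule.sub_mem _ (Submodule.sub_mem _ h1 h2) (hN j hjN)
  rwa [hornStep, sub_sub_cancel, neg_one_pow_smul_mem_F_iff, parity_mem_F_iff] at h3

end HornStep

/-- The `j`-th coface map. -/
abbrev coface (j : Fin (n + 2)) : Fin (n + 1) →o Fin (n + 2) := (Fin.succAboveOrderEmb j).toOrderHom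

theorem coord_pullT_coface (j : Fin (n + 2)) (J : Finset (Fin (n + 1)))
    (v : A ⊗[K] NCochain K (n + 1)) :
    coord K A J (pullT A (coface j) v) = coord K A (J.image j.succAbove) v := by
  rw [coord_pullT, if_pos (show Set.InjOn (coface j) _ from Fin.succAbove_right_injective.injOn)]
  rfl

theorem image_succAbove_filter {j : Fin (n + 2)} {I : Finset (Fin (n + 2))} (hj : j ∉ I) :
    (Finset.univ.filter fun a : Fin (n + 1) => j.succAbove a ∈ I).image j.succAbove = I := by
  ext i
  simp only [Finset.mem_image, Finset.mem_filter, Finset.mem_univ, true_and]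
  constructor
  · rintro ⟨a, ha, rfl⟩; exact ha
  · intro hi
    obtain ⟨a, rfl⟩ := Fin.exists_succAbove_eq (x := i) (y := j) (by rintro rfl; exact hj hi)
    exact ⟨a, hi, rfl⟩

/-- A horn of Maurer-Cartan elements that extends to an element of degree `0` extends to a
Maurer-Cartan element. -/
theorem exists_isMaurerCartan_of_horn (h𝔸 : 𝔸.IsComplete) (k : Fin (n + 2))
    {x₀ : A ⊗[K] NCochain K (n + 1)} (hx₀ : x₀ ∈ 𝔸.grExt (n + 1) 0)
    (h : ∀ j ≠ k, IsMaurerCartan (𝔸.grExt n) (𝔸.FExt n) (𝔸.QExt n) (pullT A (coface j) x₀)) :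
    ∃ x, IsMaurerCartan (𝔸.grExt (n + 1)) (𝔸.FExt (n + 1)) (𝔸.QExt (n + 1)) x ∧
      ∀ j ≠ k, pullT A (coface j) x = pullT A (coface j) x₀ := by
  -- The two coordinates that the horn does not see are reset to `0`.
  set x₁ : A ⊗[K] NCochain K (n + 1) := ofCoord K fun I =>
    if I = Finset.univ ∨ I = Finset.univ.erase k then 0 else coord K A I x₀ with hx₁
  have hx₁gr : x₁ ∈ 𝔸.grExt (n + 1) 0 := by
    rw [mem_grExt_iff]
    intro I hI
    rw [hx₁, coord_ofCoord _ hI]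
    split_ifs
    · exact Submodule.zero_mem _
    · exact (𝔸.mem_grExt_iff 0 x₀).1 hx₀ I hI
  have hx₁0 : coord K A Finset.univ x₁ = 0 := by
    rw [hx₁, coord_ofCoord _ Finset.univ_nonempty, if_pos (Or.inl rfl)]
  obtain ⟨b, hb, hbm⟩ := 𝔸.exists_coord_univ_curv_mem k h𝔸 hx₁gr hx₁0
  set x := x₁ + b ⊗ₜ NCochain.φ (oppFacet k) with hx
  have hface : ∀ j ≠ k, pullT A (coface j) x = pullT A (coface j) x₀ := by
    intro j hj
    refine coord_ext fun J hJ => ?_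
    have hjJ : j ∉ J.image j.succAbove := by
      simp only [Finset.mem_image, not_exists, not_and]
      exact fun a _ => Fin.succAbove_ne j a
    have h1 : J.image j.succAbove ≠ Finset.univ := fun he => hjJ (he ▸ Finset.mem_univ j)
    have h2 : J.image j.succAbove ≠ Finset.univ.erase k := fun he => hjJ (he ▸ by simp [hj])
    rw [coord_pullT_coface, coord_pullT_coface, hx, map_add, hx₁,
      coord_ofCoord _ (hJ.image _), if_neg (by tauto), coord_tmul, NCochain.φ_apply, if_neg h2,
      zero_smul, add_zero]
  refine ⟨x, 𝔸.isMaurerCartan_of_coord_curv k (𝔸.add_tmul_φ_mem_grExt k hx₁gr hb) fun m => ?_, hface⟩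
  obtain ⟨N₀, hN₀⟩ := hbm m
  -- Curvature commutes with restriction, so convergence on each facet of the horn is inherited. The
  -- bound depends on `j`, and the supremum over the finitely many facets is taken.
  have hN : ∀ j : Fin (n + 2), ∃ N, j ≠ k → ∀ N' ≥ N,
      pullT A (coface j) (𝔸.curv (n + 1) N' x) ∈ 𝔸.FExt n m := by
    intro j
    by_cases hj : j = k
    · exact ⟨0, fun h => absurd hj h⟩
    · obtain ⟨N, hN⟩ := (h j hj).2 m
      refine ⟨N, fun _ N' hN' => ?_⟩
      rw [pullT_curv, hface j hj]
      exact hN N' hN'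
  choose N hN using hN
  refine ⟨max N₀ (Finset.univ.sup N), fun N' hN' I hI hIk => ?_⟩
  by_cases hIu : I = Finset.univ
  · rw [hIu]
    exact hN₀ N' ((le_max_left _ _).trans hN')
  -- A simplex other than the top one and the facet opposite `k` lies in a facet of the horn.
  obtain ⟨j, hjk, hjI⟩ : ∃ j, j ≠ k ∧ j ∉ I := by
    by_contra hno
    push Not at hno
    by_cases hk : k ∈ I
    · apply hIu
      ext i
      by_cases hi : i = k
      · simp [hi, hk]
      · simp [hno i hi]
    · apply hIk
      ext i
      by_cases hi : i = k
      · simp [hi, hk]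
      · simp [hi, hno i hi]
  have := 𝔸.coord_mem_F (hN j hjk N' ((Finset.le_sup (Finset.mem_univ j)).trans
    ((le_max_right _ _).trans hN'))) (Finset.univ.filter fun a : Fin (n + 1) => j.succAbove a ∈ I)
  rwa [coord_pullT_coface, image_succAbove_filter hjI] at this

end FilteredShiftedAInfAlgebra

end

/-! ### Gluing the facets of a horn and the Kan condition. -/

section

variable {K : Type v} [Field K] {A : Type u} [AddCommGroup A] [Module K A] {n : ℕ}

namespace FilteredShiftedAInfAlgebra

open ShiftedAInfAlgebra

variable (𝔸 : FilteredShiftedAInfAlgebra K A)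

/-- The preimage of a simplex under the `j`-th coface map. -/
abbrev faceOf (j : Fin (n + 2)) (I : Finset (Fin (n + 2))) : Finset (Fin (n + 1)) :=
  Finset.univ.filter fun a => j.succAbove a ∈ I

/-- A family of cochains on the facets of a horn that agree on common simplices extends to the whole
simplex. -/
theorem exists_pullT_coface_eq (k : Fin (n + 2)) (y : ∀ j, j ≠ k → A ⊗[K] NCochain K n) (r : ℤ)
    (hy : ∀ j hj, y j hj ∈ 𝔸.grExt n r)
    (hc : ∀ j hj j' hj', j < j' → ∀ I : Finset (Fin (n + 2)), I.Nonempty → j ∉ I → j' ∉ I →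
      coord K A (faceOf j I) (y j hj) = coord K A (faceOf j' I) (y j' hj')) :
    ∃ x ∈ 𝔸.grExt (n + 1) r, ∀ j hj, pullT A (coface j) x = y j hj := by
  classical
  -- Each coordinate is read off on an arbitrarily chosen facet of the horn containing `I`;
  -- compatibility `hc` makes the choice irrelevant.
  set w : Finset (Fin (n + 2)) → A := fun I =>
    if h : ∃ j, j ≠ k ∧ j ∉ I then coord K A (faceOf h.choose I) (y h.choose h.choose_spec.1) else 0
    with hw
  have hwj : ∀ j hj I, I.Nonempty → j ∉ I → w I = coord K A (faceOf j I) (y j hj) := by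
    intro j hj I hI hjI
    have h : ∃ j, j ≠ k ∧ j ∉ I := ⟨j, hj, hjI⟩
    simp only [hw, dif_pos h]
    rcases lt_trichotomy h.choose j with hlt | heq | hlt
    · exact hc _ _ _ _ hlt I hI h.choose_spec.2 hjI
    · have : ∀ i hi, i = j → coord K A (faceOf i I) (y i hi) = coord K A (faceOf j I) (y j hj) := by
        rintro i _ rfl; rfl
      exact this _ _ heq
    · exact (hc _ _ _ _ hlt I hI hjI h.choose_spec.2).symm
  refine ⟨ofCoord K w, ?_, fun j hj => coord_ext fun J hJ => ?_⟩
  · rw [mem_grExt_iff]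
    intro I hI
    rw [coord_ofCoord _ hI]
    by_cases h : ∃ j, j ≠ k ∧ j ∉ I
    · obtain ⟨j, hj, hjI⟩ := h
      rw [hwj j hj I hI hjI]
      have hne : (faceOf j I).Nonempty := by
        rw [← Finset.image_nonempty (f := j.succAbove), image_succAbove_filter hjI]; exact hI
      have := (𝔸.mem_grExt_iff r _).1 (hy j hj) (faceOf j I) hne
      rwa [← Finset.card_image_of_injective _ (Fin.succAbove_right_injective (p := j)),
        image_succAbove_filter hjI] at this
    · simp only [hw, dif_neg h]
      exact Submodule.zero_mem _
  · have hjJ : j ∉ J.image j.succAbove := by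
      simp only [Finset.mem_image, not_exists, not_and]
      exact fun a _ => Fin.succAbove_ne j a
    have hf : faceOf j (J.image j.succAbove) = J := by
      ext a
      simp [Fin.succAbove_right_injective.eq_iff]
    rw [coord_pullT_coface, coord_ofCoord _ (hJ.image _), hwj j hj _ (hJ.image _) hjJ, hf]

/-- The compatibility of the facets of a horn, in coordinates. -/
theorem coord_faceOf_eq {j j' : Fin (n + 3)} (hjj' : j < j') {y y' : A ⊗[K] NCochain K (n + 1)}
    (h : pullT A (coface (j'.pred (Fin.ne_zero_of_lt hjj'))) y =
      pullT A (coface (j.castPred (Fin.ne_last_of_lt hjj'))) y')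
    {I : Finset (Fin (n + 3))} (hj : j ∉ I) (hj' : j' ∉ I) :
    coord K A (faceOf j I) y = coord K A (faceOf j' I) y' := by
  set a := j'.pred (Fin.ne_zero_of_lt hjj') with ha
  set b := j.castPred (Fin.ne_last_of_lt hjj') with hb
  have h1 : j.succAbove a = j' := by
    rw [ha, Fin.succAbove_pred_of_lt _ _ hjj']
  have h2 : j'.succAbove b = j := by
    rw [hb, Fin.succAbove_castPred_of_lt _ _ hjj']
  -- The cosimplicial identity: both composites omit the vertices `j` and `j'`.
  have hcomm : ∀ i : Fin (n + 1), j.succAbove (a.succAbove i) = j'.succAbove (b.succAbove i) := by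
    intro i
    have hlt : (j : ℕ) < j' := hjj'
    apply Fin.ext
    simp only [ha, hb, Fin.succAbove, Fin.lt_def, Fin.val_castSucc, Fin.val_pred, Fin.coe_castPred]
    split_ifs <;> simp_all <;> omega
  have ha' : a ∉ faceOf j I := by simp [h1, hj']
  have hb' : b ∉ faceOf j' I := by simp [h2, hj]
  have hL : faceOf a (faceOf j I) = faceOf b (faceOf j' I) := by
    ext i; simp [hcomm]
  rw [← image_succAbove_filter ha', ← image_succAbove_filter hb', ← coord_pullT_coface,
    ← coord_pullT_coface, h]
  exact congrArg (fun L => coord K A L _) hL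

open CategoryTheory Simplicial in
/-- The Maurer-Cartan simplicial set of a complete `A_∞`-algebra is a Kan complex. -/
theorem kanComplex_MC (h𝔸 : 𝔸.IsComplete) : SSet.KanComplex 𝔸.MC := by
  rw [SSet.KanComplex.iff]
  intro n k f hf
  have hδ : ∀ (m : ℕ) (j : Fin (m + 2)) (g : Δ[m + 1] ⟶ 𝔸.MC),
      (SSet.yonedaEquiv (SSet.stdSimplex.δ j ≫ g)).1 =
        pullT A (coface j) (SSet.yonedaEquiv g).1 := by
    intro m j g
    rw [SSet.stdSimplex.yonedaEquiv_δ_comp]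
    rfl
  obtain ⟨x₀, hx₀, hx₀f⟩ := 𝔸.exists_pullT_coface_eq k
    (fun j hj => (SSet.yonedaEquiv (f j hj)).1) 0 (fun j hj => (SSet.yonedaEquiv (f j hj)).2.1) (by
      intro j hj j' hj' hlt I hI hjI hj'I
      cases n with
      -- The horn in `Δ^1` imposes no compatibility: no vertex avoids two distinct vertices of an
      -- edge.
      | zero =>
        exfalso
        obtain ⟨i, hi⟩ := hI
        have h1 : i ≠ j := fun h => hjI (h ▸ hi)
        have h2 : i ≠ j' := fun h => hj'I (h ▸ hi)
        omega
      | succ n =>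
        refine coord_faceOf_eq hlt ?_ hjI hj'I
        rw [← hδ, ← hδ, hf j j' hj hj' hlt])
  obtain ⟨x, hx, hxf⟩ := 𝔸.exists_isMaurerCartan_of_horn h𝔸 k hx₀ fun j hj => by
    rw [hx₀f j hj]
    exact (SSet.yonedaEquiv (f j hj)).2
  refine ⟨SSet.yonedaEquiv.symm (show 𝔸.MC.obj (Opposite.op ⦋n + 1⦌) from ⟨x, hx⟩), fun j hj => ?_⟩
  apply SSet.yonedaEquiv.injective
  apply Subtype.ext
  rw [hδ, Equiv.apply_symm_apply, ← hx₀f j hj]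
  exact hxf j hj

end FilteredShiftedAInfAlgebra

end

end AInf

theorem mainTheorem1 {K : Type v} [Field K] {A : Type u} [AddCommGroup A] [Module K A]
    (𝔸 : AInf.FilteredShiftedAInfAlgebra K A) (h𝔸 : 𝔸.IsComplete) :
    SSet.KanComplex 𝔸.MC :=
  𝔸.kanComplex_MC h𝔸
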